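/- Consider the word RAM with $w$-bit words: a fixed finite program works on registers and on a memory of words, and each arithmetic operation ($+,-,\cdot$ modulo $2^w$, integer division and remainder), bitwise operation, shift, comparison, memory access and branch takes unit time. For every constant $c$ there are query programs and constants $A,B$, all depending only on $c$, such that the following holds for every integer $n\ge 3$ and every word size $w$ with $2^w\ge A n$ (that is, $w\ge\log_2 n+O(1)$). Let $S$ be a set of at most $cn$ points $(x',y')$ with integer coordinates and $1\le y'\le x'\le n$, i.e. on or below the main diagonal of the $n\times n$ integer grid. Then there is a data structure for $S$ that occupies at most $An$ words of memory and on which the query programs answer every dominance counting query: given a point $(x,y)\in\{1,\dots,n\}^2$ and a choice of one of the four closed axis-parallel quadrants with apex $(x,y)$ (for instance $\{(x',y') : x'\le x,\ y'\ge y\}$), the program for this kind of quadrant returns the number of points of $S$ in the quadrant, leaves the data structure unchanged, and takes time at most $$B\left(1+\frac{\log d}{\log\log n}\right),\qquad d=|x-y|,$$ where $\log d$ is read as $0$ for $d=0$. (Here $d$ is $\sqrt2$ times the Euclidean distance of the query point from the main diagonal.) In short: linear space and query time $O(1+\log d/\log\log n)$. -/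

import Mathlib

namespace WordRAM

/-- The unit-cost binary operations on `w`-bit words. -/
inductive BinOp where
  | add | sub | mul | div | mod
  | and | or | xor | shl | shr
  | lt | eq

/-- Arithmetic is unsigned and modulo `2 ^ w`, division rounds down, comparisons return the word
`1` (true) or `0` (false). -/
def BinOp.apply {w : ℕ} : BinOp → BitVec w → BitVec w → BitVec w
  | .add, a, b => a + b
  | .sub, a, b => a - b
  | .mul, a, b => a * b
  | .div, a, b => a / b
  | .mod, a, b => a % b
  | .and, a, b => a &&& b
  | .or, a, b => a ||| b
  | .xor, a, b => a ^^^ b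
  | .shl, a, b => a <<< b
  | .shr, a, b => a >>> b
  | .lt, a, b => if a.toNat < b.toNat then BitVec.ofNat w 1 else BitVec.ofNat w 0
  | .eq, a, b => if a.toNat = b.toNat then BitVec.ofNat w 1 else BitVec.ofNat w 0

/-- A configuration of the machine with word size `w`: registers, each holding one word, and a
memory, a finite array of words. A program mentions only finitely many registers. -/
structure State (w : ℕ) where
  reg : ℕ → BitVec w
  mem : List (BitVec w)

/-- Expressions: literals, registers, binary operations, and reading the memory cell whose address
is the value of a subexpression. The expressions do not depend on the word size. -/
inductive Expr where
  | lit (k : ℕ)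
  | reg (r : ℕ)
  | bin (o : BinOp) (a b : Expr)
  | load (a : Expr)

/-- The value of an expression; undefined (`none`) if it reads outside the memory. -/
def Expr.eval {w : ℕ} (s : State w) : Expr → Option (BitVec w)
  | .lit k => some (BitVec.ofNat w k)
  | .reg r => some (s.reg r)
  | .bin o a b => (a.eval s).bind fun u => (b.eval s).bind fun v => some (o.apply u v)
  | .load a => (a.eval s).bind fun u => s.mem[u.toNat]?

/-- The time to evaluate an expression: one unit for every literal, register access, operation and
memory access. -/
def Expr.cost : Expr → ℕ
  | .lit _ => 1
  | .reg _ => 1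
  | .bin _ a b => a.cost + b.cost + 1
  | .load a => a.cost + 1

/-- Programs. They are finite objects that do not depend on the word size or on the input. -/
inductive Prog where
  | skip
  | assign (r : ℕ) (e : Expr)
  | store (addr val : Expr)
  | seq (p q : Prog)
  | ite (e : Expr) (p q : Prog)
  | loop (e : Expr) (p : Prog)

/-- `Exec p s t s'`: the program `p`, started in `s`, halts in `s'` after exactly `t` time units.
A read or write outside the memory aborts the run (no rule applies). The branch `ite e p q` runs
`p` if `e` is nonzero and `q` otherwise; `loop e p` repeats `p` while `e` is nonzero. -/
inductive Exec {w : ℕ} : Prog → State w → ℕ → State w → Prop where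
  | skip (s : State w) : Exec .skip s 1 s
  | assign (r : ℕ) (e : Expr) (s : State w) (v : BitVec w) (he : e.eval s = some v) :
      Exec (.assign r e) s (e.cost + 1) { s with reg := Function.update s.reg r v }
  | store (addr val : Expr) (s : State w) (u v : BitVec w) (hu : addr.eval s = some u)
      (hv : val.eval s = some v) (hlt : u.toNat < s.mem.length) :
      Exec (.store addr val) s (addr.cost + val.cost + 1) { s with mem := s.mem.set u.toNat v }
  | seq (p q : Prog) (s₁ s₂ s₃ : State w) (t₁ t₂ : ℕ) (hp : Exec p s₁ t₁ s₂)
      (hq : Exec q s₂ t₂ s₃) : Exec (.seq p q) s₁ (t₁ + t₂) s₃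
  | ite_true (e : Expr) (p q : Prog) (s s' : State w) (v : BitVec w) (t : ℕ)
      (he : e.eval s = some v) (hv : v.toNat ≠ 0) (hp : Exec p s t s') :
      Exec (.ite e p q) s (e.cost + 1 + t) s'
  | ite_false (e : Expr) (p q : Prog) (s s' : State w) (v : BitVec w) (t : ℕ)
      (he : e.eval s = some v) (hv : v.toNat = 0) (hq : Exec q s t s') :
      Exec (.ite e p q) s (e.cost + 1 + t) s'
  | loop_done (e : Expr) (p : Prog) (s : State w) (v : BitVec w) (he : e.eval s = some v)
      (hv : v.toNat = 0) : Exec (.loop e p) s (e.cost + 1) s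
  | loop_step (e : Expr) (p : Prog) (s₁ s₂ s₃ : State w) (v : BitVec w) (t₁ t₂ : ℕ)
      (he : e.eval s₁ = some v) (hv : v.toNat ≠ 0) (hp : Exec p s₁ t₁ s₂)
      (hl : Exec (.loop e p) s₂ t₂ s₃) : Exec (.loop e p) s₁ (e.cost + 1 + t₁ + t₂) s₃

/-- The start of a query `(x, y)`: the memory holds the data structure, registers `0` and `1` hold
`x` and `y`, and all other registers are zero. -/
def queryState {w : ℕ} (mem : List (BitVec w)) (x y : ℕ) : State w where
  reg := fun r => if r = 0 then BitVec.ofNat w x else if r = 1 then BitVec.ofNat w y else 0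
  mem := mem

end WordRAM

/-- The four closed axis-parallel quadrants with a given apex. -/
inductive Quadrant where
  | leLe | leGe | geLe | geGe

/-- The number of points of `S` in the quadrant of the given kind with apex `(x, y)`. -/
def dominanceCount (S : Finset (ℕ × ℕ)) (x y : ℕ) : Quadrant → ℕ
  | .leLe => (S.filter fun p => p.1 ≤ x ∧ p.2 ≤ y).card
  | .leGe => (S.filter fun p => p.1 ≤ x ∧ y ≤ p.2).card
  | .geLe => (S.filter fun p => x ≤ p.1 ∧ p.2 ≤ y).card
  | .geGe => (S.filter fun p => x ≤ p.1 ∧ y ≤ p.2).card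

/-- `S` lies in the grid `{1, …, n} × {1, …, n}`, on or below the main diagonal. -/
def BelowDiagonal (n : ℕ) (S : Finset (ℕ × ℕ)) : Prop :=
  ∀ p ∈ S, 1 ≤ p.2 ∧ p.2 ≤ p.1 ∧ p.1 ≤ n

/-!
By inclusion and exclusion, a dominance count is determined by the numbers of points in the first
rows and in the first columns and by the number of points in the columns before some `b` and the
rows from some `a` on. Below the diagonal, the latter points have their rows in `[a, b)`, and
`d = b - a` is at most `|x - y| + 1`.

To count them, the rows are cut into strips of height `2 * K`, one starting at every multiple of
`K`, where `K ≥ d`, so that some strip contains `[a, b)`. Relative to the lower left corner of its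
strip, the column of a point becomes a key below `2 * K`, cut off at the top: it has
`O(1 + log d / log log n)` digits in base `f`, where `f` is a small power of `log n`. What remains
is to count the keys below a bound in an interval of the list of all keys by rows. A radix sort of
this list, most significant digit first, maps the keys in an interval that share their leading digit
to an interval of the next list, so one round per digit suffices, each with constantly many
questions for the rank of a digit at a position.

Packing `Θ(log n / log log n)` digits into a word, with counts at the boundaries of blocks and
superblocks and a table of all blocks, answers a rank question in constant time and stores one
digit of all keys in `O((n + |S|) * log log n / log n)` words. Spans `d` are grouped by doubling
numbers of digits, so that `O(log n / log log n)` digit sequences serve all of them.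
-/

namespace WordRAM

instance (k : ℕ) : OfNat Expr k := ⟨.lit k⟩
instance : Add Expr := ⟨.bin .add⟩
instance : Sub Expr := ⟨.bin .sub⟩
instance : Mul Expr := ⟨.bin .mul⟩
instance : Div Expr := ⟨.bin .div⟩
instance : Mod Expr := ⟨.bin .mod⟩

/-- The state has memory `μ`, and the numerical values of its registers are `ρ`. -/
def State.Holds {w : ℕ} (s : State w) (μ : List (BitVec w)) (ρ : ℕ → ℕ) : Prop :=
  s.mem = μ ∧ ∀ r, (s.reg r).toNat = ρ r

/-- On memory `μ` and register values `ρ`, the expression `e` is defined and denotes the natural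
number `v`, with no wrap-around modulo `2 ^ w`. -/
def Evaluates {w : ℕ} (μ : List (BitVec w)) (ρ : ℕ → ℕ) (e : Expr) (v : ℕ) : Prop :=
  ∀ s : State w, s.Holds μ ρ → ∃ u : BitVec w, e.eval s = some u ∧ u.toNat = v

namespace Evaluates

variable {w : ℕ} {μ : List (BitVec w)} {ρ : ℕ → ℕ} {a b e : Expr} {u v : ℕ}

theorem lit {k : ℕ} (hk : k < 2 ^ w) : Evaluates μ ρ (.lit k) k := fun _ _ =>
  ⟨BitVec.ofNat w k, rfl, by rw [BitVec.toNat_ofNat, Nat.mod_eq_of_lt hk]⟩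

theorem reg (r : ℕ) : Evaluates μ ρ (.reg r) (ρ r) := fun s hs => ⟨s.reg r, rfl, hs.2 r⟩

theorem bin {o : BinOp} {z : ℕ} (ha : Evaluates μ ρ a u) (hb : Evaluates μ ρ b v)
    (h : ∀ x y : BitVec w, x.toNat = u → y.toNat = v → (o.apply x y).toNat = z) :
    Evaluates μ ρ (.bin o a b) z := fun s hs => by
  obtain ⟨x, hx, hx'⟩ := ha s hs
  obtain ⟨y, hy, hy'⟩ := hb s hs
  exact ⟨o.apply x y, by simp [Expr.eval, hx, hy], h x y hx' hy'⟩

theorem add (ha : Evaluates μ ρ a u) (hb : Evaluates μ ρ b v) (h : u + v < 2 ^ w) :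
    Evaluates μ ρ (a + b) (u + v) :=
  ha.bin hb fun x y hx hy => by simp [BinOp.apply, hx, hy, Nat.mod_eq_of_lt h]

theorem sub (ha : Evaluates μ ρ a u) (hb : Evaluates μ ρ b v) (h : v ≤ u) :
    Evaluates μ ρ (a - b) (u - v) :=
  ha.bin hb fun x y hx hy => by
    have hyx : y ≤ x := by rw [BitVec.le_def]; omega
    simp [BinOp.apply, BitVec.toNat_sub_of_le hyx, hx, hy]

theorem mul (ha : Evaluates μ ρ a u) (hb : Evaluates μ ρ b v) (h : u * v < 2 ^ w) :
    Evaluates μ ρ (a * b) (u * v) :=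
  ha.bin hb fun x y hx hy => by simp [BinOp.apply, hx, hy, Nat.mod_eq_of_lt h]

theorem div (ha : Evaluates μ ρ a u) (hb : Evaluates μ ρ b v) : Evaluates μ ρ (a / b) (u / v) :=
  ha.bin hb fun x y hx hy => by simp [BinOp.apply, hx, hy]

theorem mod (ha : Evaluates μ ρ a u) (hb : Evaluates μ ρ b v) : Evaluates μ ρ (a % b) (u % v) :=
  ha.bin hb fun x y hx hy => by simp [BinOp.apply, hx, hy]

theorem lt (ha : Evaluates μ ρ a u) (hb : Evaluates μ ρ b v) (hw : 1 < 2 ^ w) :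
    Evaluates μ ρ (.bin .lt a b) (if u < v then 1 else 0) :=
  ha.bin hb fun x y hx hy => by
    simp only [BinOp.apply, hx, hy]
    split <;> simp [Nat.mod_eq_of_lt hw]

theorem load {z : BitVec w} (ha : Evaluates μ ρ a u) (h : μ[u]? = some z) :
    Evaluates μ ρ (.load a) z.toNat := fun s hs => by
  obtain ⟨x, hx, hx'⟩ := ha s hs
  exact ⟨z, by simp [Expr.eval, hx, hx', hs.1, h], rfl⟩

theorem congr (h : Evaluates μ ρ e u) (huv : u = v) : Evaluates μ ρ e v := huv ▸ h

theorem mul_add {z : ℕ} (ha : Evaluates μ ρ a u) (hb : Evaluates μ ρ b v) (he : Evaluates μ ρ e z)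
    (h : u * v + z < 2 ^ w) : Evaluates μ ρ (a * b + e) (u * v + z) :=
  (ha.mul hb (by omega)).add he h

end Evaluates

/-- Started with memory `μ` and register values `ρ`, the program `p` halts within `t` time units,
with unchanged memory and with register values that satisfy `P`. -/
def Runs {w : ℕ} (μ : List (BitVec w)) (p : Prog) (ρ : ℕ → ℕ) (t : ℕ) (P : (ℕ → ℕ) → Prop) :
    Prop :=
  ∀ s : State w, s.Holds μ ρ →
    ∃ t' ≤ t, ∃ s' ρ', Exec p s t' s' ∧ s'.Holds μ ρ' ∧ P ρ'

namespace Runs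

variable {w : ℕ} {μ : List (BitVec w)} {ρ : ℕ → ℕ} {P P' : (ℕ → ℕ) → Prop} {p q : Prog} {e : Expr}
  {r v t t' : ℕ}

theorem skip (h : P ρ) : Runs μ .skip ρ 1 P := fun s hs =>
  ⟨1, le_rfl, s, ρ, Exec.skip s, hs, h⟩

theorem assign (he : Evaluates μ ρ e v) (h : P (Function.update ρ r v)) :
    Runs μ (.assign r e) ρ (e.cost + 1) P := fun s hs => by
  obtain ⟨x, hx, hx'⟩ := he s hs
  refine ⟨_, le_rfl, _, _, Exec.assign r e s x hx, ⟨hs.1, fun r' => ?_⟩, h⟩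
  rcases eq_or_ne r' r with rfl | hr
  · simp [hx']
  · simp [hr, hs.2 r']

theorem seq (h : Runs μ p ρ t fun ρ' => Runs μ q ρ' t' P) : Runs μ (.seq p q) ρ (t + t') P :=
  fun s hs => by
    obtain ⟨t₁, ht₁, s₁, ρ₁, hp, hs₁, hq⟩ := h s hs
    obtain ⟨t₂, ht₂, s₂, ρ₂, hq, hs₂, hP⟩ := hq s₁ hs₁
    exact ⟨_, by omega, _, _, Exec.seq _ _ _ _ _ _ _ hp hq, hs₂, hP⟩

theorem assign_seq (he : Evaluates μ ρ e v) (h : Runs μ q (Function.update ρ r v) t P) :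
    Runs μ (.seq (.assign r e) q) ρ (e.cost + 1 + t) P :=
  seq (assign he h)

theorem ite (he : Evaluates μ ρ e v) (hp : v ≠ 0 → Runs μ p ρ t P)
    (hq : v = 0 → Runs μ q ρ t' P) : Runs μ (.ite e p q) ρ (e.cost + 1 + max t t') P :=
  fun s hs => by
    obtain ⟨x, hx, hxv⟩ := he s hs
    by_cases hv : v = 0
    · obtain ⟨t₁, ht₁, s₁, ρ₁, h, hs₁, hP⟩ := hq hv s hs
      exact ⟨_, by omega, _, _, Exec.ite_false _ _ _ _ _ x _ hx (by omega) h, hs₁, hP⟩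
    · obtain ⟨t₁, ht₁, s₁, ρ₁, h, hs₁, hP⟩ := hp hv s hs
      exact ⟨_, by omega, _, _, Exec.ite_true _ _ _ _ _ x _ hx (by omega) h, hs₁, hP⟩

theorem loop {I : ℕ → (ℕ → ℕ) → Prop} (hcond : ∀ k ρ, I k ρ → Evaluates μ ρ e k)
    (hbody : ∀ k ρ, I (k + 1) ρ → Runs μ p ρ t (I k)) {k : ℕ} (h : I k ρ) :
    Runs μ (.loop e p) ρ (k * (e.cost + 1 + t) + (e.cost + 1)) (I 0) := by
  induction k generalizing ρ with
  | zero =>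
    intro s hs
    obtain ⟨x, hx, hx0⟩ := hcond 0 ρ h s hs
    exact ⟨_, by simp, _, _, Exec.loop_done _ _ _ x hx hx0, hs, h⟩
  | succ k ih =>
    intro s hs
    obtain ⟨x, hx, hxk⟩ := hcond (k + 1) ρ h s hs
    obtain ⟨t₁, ht₁, s₁, ρ₁, hp, hs₁, h₁⟩ := hbody k ρ h s hs
    obtain ⟨t₂, ht₂, s₂, ρ₂, hl, hs₂, h₂⟩ := ih h₁ s₁ hs₁
    refine ⟨_, ?_, _, _, Exec.loop_step _ _ _ _ _ x _ _ hx (by omega) hp hl, hs₂, h₂⟩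
    rw [add_one_mul]
    omega

theorem mono (h : Runs μ p ρ t P) (ht : t ≤ t') (hP : ∀ ρ', P ρ' → P' ρ') : Runs μ p ρ t' P' :=
  fun s hs =>
    let ⟨t₁, ht₁, s₁, ρ₁, hp, hs₁, h₁⟩ := h s hs
    ⟨t₁, ht₁.trans ht, s₁, ρ₁, hp, hs₁, hP _ h₁⟩

end Runs

/-- The time of a run of the program in which every branch takes its more expensive side and no
loop body is ever executed. -/
def Prog.baseCost : Prog → ℕ
  | .skip => 1
  | .assign _ e => e.cost + 1
  | .store a v => a.cost + v.cost + 1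
  | .seq p q => p.baseCost + q.baseCost
  | .ite e p q => e.cost + 1 + max p.baseCost q.baseCost
  | .loop e _ => e.cost + 1

/-- A memory that interleaves `k` arrays of length `Z`: entry `j` of array `r` is in cell
`k * j + r`, so that addresses can be computed without knowing `Z`. -/
def interleave (w k Z : ℕ) (R : ℕ → ℕ → ℕ) : List (BitVec w) :=
  (List.range (k * Z)).map fun i => BitVec.ofNat w (R (i % k) (i / k))

theorem length_interleave (w k Z : ℕ) (R : ℕ → ℕ → ℕ) :
    (interleave w k Z R).length = k * Z := by
  simp [interleave]

/-- The expression that reads entry `e` of array `r` of `k` interleaved arrays. -/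
def readEntry (k r : ℕ) (e : Expr) : Expr := .load (.lit k * e + .lit r)

theorem Evaluates.readEntry {w k Z r j : ℕ} {R : ℕ → ℕ → ℕ} {ρ : ℕ → ℕ} {e : Expr}
    (he : Evaluates (interleave w k Z R) ρ e j) (hr : r < k) (hj : j < Z)
    (hw : k * (Z + 1) ≤ 2 ^ w) (hR : R r j < 2 ^ w) :
    Evaluates (interleave w k Z R) ρ (readEntry k r e) (R r j) := by
  have hcell : k * j + r < k * Z := by nlinarith
  rw [Nat.mul_add_one] at hw
  have hentry : (interleave w k Z R)[k * j + r]? = some (BitVec.ofNat w (R r j)) := by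
    rw [interleave, List.getElem?_map, List.getElem?_range hcell, Option.map_some,
      Nat.mul_add_mod, Nat.mod_eq_of_lt hr, Nat.mul_add_div (by omega), Nat.div_eq_of_lt hr,
      add_zero]
  refine (load (mul_add (lit ?_) he (lit ?_) ?_) hentry).congr ?_
  · nlinarith
  · omega
  · omega
  · rw [BitVec.toNat_ofNat, Nat.mod_eq_of_lt hR]

end WordRAM

section Packing

/-- The number whose digits in base `B` are `h 0, …, h (m - 1)`, least significant digit first. -/
def packDigits (B m : ℕ) (h : ℕ → ℕ) : ℕ := Nat.ofDigits B ((List.range m).map h)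

variable {B : ℕ} {h : ℕ → ℕ}

theorem packDigits_lt (hB : 1 < B) (hh : ∀ i, h i < B) (m : ℕ) : packDigits B m h < B ^ m := by
  simpa [packDigits] using
    Nat.ofDigits_lt_base_pow_length (l := (List.range m).map h) hB (by simpa using fun i _ => hh i)

theorem packDigits_div_mod (hh : ∀ i, h i < B) {m i : ℕ} (hi : i < m) :
    packDigits B m h / B ^ i % B = h i := by
  rw [packDigits, Nat.ofDigits_div_pow_eq_ofDigits_drop i ((Nat.zero_le _).trans_lt (hh 0)) _
    (by simpa using fun i _ => hh i), Nat.ofDigits_mod_eq_head!,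
    List.drop_eq_getElem_cons (by simpa)]
  simp [Nat.mod_eq_of_lt (hh i)]

end Packing

/-- The parameters of a family of rank structures: for every `t` a sequence `digit t` of `size`
digits smaller than `base`, split into blocks of `blockLen` digits. The counts at the block
boundaries are stored as digits in base `radix`. -/
structure RankDirectory where
  size : ℕ
  base : ℕ
  blockLen : ℕ
  radix : ℕ
  digit : ℕ → ℕ → ℕ

namespace RankDirectory

variable (D : RankDirectory)

/-- The number of digits smaller than `a` among the first `p` digits of sequence `t`. -/
def rank (t a p : ℕ) : ℕ := Nat.count (fun i => D.digit t i < a) p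

/-- The number of digit bounds `a` for which ranks are asked: `0, …, base`. -/
def width : ℕ := D.base + 1

/-- The length of a superblock, at whose boundaries ranks are stored in full. -/
def superLen : ℕ := D.blockLen * D.width

/-- The number of blocks of one sequence, including a last block that may be incomplete. -/
def blockCount : ℕ := D.size / D.blockLen + 1

/-- The number of superblocks of one sequence. -/
def superCount : ℕ := D.size / D.superLen + 1

/-- All ranks inside all possible blocks: entry `(c * blockLen + j) * width + a` is the number of
digits smaller than `a` among the `j` least significant digits of `c`. -/
def blockTable (i : ℕ) : ℕ :=
  Nat.count (fun j => i / D.width / D.blockLen / D.base ^ j % D.base < i % D.width)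
    (i / D.width % D.blockLen)

/-- The digits of block `q` of sequence `t`, packed into the word number `t * blockCount + q`. -/
def digitWord (i : ℕ) : ℕ :=
  packDigits D.base D.blockLen fun j =>
    D.digit (i / D.blockCount) (D.blockLen * (i % D.blockCount) + j)

/-- The ranks at superblock boundaries; entry `(t * superCount + q) * width + a` is the rank of the
digit bound `a` at the start of superblock `q` of sequence `t`. -/
def superRank (i : ℕ) : ℕ :=
  D.rank (i / D.width / D.superCount) (i % D.width) (D.superLen * (i / D.width % D.superCount))

/-- The rank at the start of block `q`, relative to the start of its superblock. -/
def blockRank (t q a : ℕ) : ℕ :=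
  D.rank t a (D.blockLen * q) - D.rank t a (D.superLen * (q / D.width))

/-- The relative ranks of block `q` of sequence `t` for all digit bounds, packed into the word
number `t * blockCount + q`. -/
def blockRankWord (i : ℕ) : ℕ :=
  packDigits D.radix D.width (D.blockRank (i / D.blockCount) (i % D.blockCount))

variable {D}

theorem mul_add_div_of_lt {a b c : ℕ} (h : c < b) : (a * b + c) / b = a := by
  rw [mul_comm, Nat.mul_add_div (by omega), Nat.div_eq_of_lt h, add_zero]

theorem mul_add_lt_mul {a b c A : ℕ} (ha : a < A) (hc : c < b) : a * b + c < A * b := by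
  nlinarith [Nat.mul_le_mul_right b (Nat.succ_le_of_lt ha)]

theorem rank_le (t a p : ℕ) : D.rank t a p ≤ p := Nat.count_le _

theorem rank_mono_right (t a : ℕ) {p q : ℕ} (h : p ≤ q) : D.rank t a p ≤ D.rank t a q :=
  Nat.count_monotone _ h

theorem rank_mono_left (t p : ℕ) {a a' : ℕ} (h : a ≤ a') : D.rank t a p ≤ D.rank t a' p :=
  Nat.count_mono_left fun _ _ hi => hi.trans_le h

theorem rank_add (t a p q : ℕ) :
    D.rank t a (p + q) = D.rank t a p + Nat.count (fun i => D.digit t (p + i) < a) q :=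
  Nat.count_add _ _ _

theorem superLen_mul_div_le (q : ℕ) : D.superLen * (q / D.width) ≤ D.blockLen * q := by
  rw [superLen, mul_assoc]
  exact Nat.mul_le_mul_left _ (Nat.mul_div_le _ _)

theorem blockRank_le (t q a : ℕ) : D.blockRank t q a ≤ D.superLen := by
  have hsplit : D.blockLen * q = D.superLen * (q / D.width) + D.blockLen * (q % D.width) := by
    rw [superLen, mul_assoc, ← mul_add, Nat.div_add_mod]
  rw [blockRank, hsplit, rank_add, Nat.add_sub_cancel_left]
  exact (Nat.count_le _).trans
    (Nat.mul_le_mul_left _ (Nat.mod_lt _ (Nat.succ_pos D.base)).le)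

theorem superRank_apply {t q a : ℕ} (hq : q < D.superCount) (ha : a < D.width) :
    D.superRank ((t * D.superCount + q) * D.width + a) = D.rank t a (D.superLen * q) := by
  simp only [superRank, mul_add_div_of_lt ha, Nat.mul_add_mod_of_lt ha, mul_add_div_of_lt hq,
    Nat.mul_add_mod_of_lt hq]

theorem blockRankWord_div_mod (hV : D.superLen < D.radix) {t q a : ℕ} (hq : q < D.blockCount)
    (ha : a < D.width) :
    D.blockRankWord (t * D.blockCount + q) / D.radix ^ a % D.radix = D.blockRank t q a := by
  rw [blockRankWord, mul_add_div_of_lt hq, Nat.mul_add_mod_of_lt hq,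
    packDigits_div_mod (fun i => (blockRank_le _ _ i).trans_lt hV) ha]

theorem blockTable_digitWord (hdigit : ∀ t i, D.digit t i < D.base) {t q j a : ℕ}
    (hq : q < D.blockCount) (hj : j < D.blockLen) (ha : a < D.width) :
    D.blockTable ((D.digitWord (t * D.blockCount + q) * D.blockLen + j) * D.width + a) =
      Nat.count (fun i => D.digit t (D.blockLen * q + i) < a) j := by
  simp only [blockTable, mul_add_div_of_lt ha, Nat.mul_add_mod_of_lt ha, mul_add_div_of_lt hj,
    Nat.mul_add_mod_of_lt hj, digitWord, mul_add_div_of_lt hq, Nat.mul_add_mod_of_lt hq]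
  have hword (i : ℕ) (hi : i < j) :=
    packDigits_div_mod (fun i => hdigit t (D.blockLen * q + i)) (hi.trans hj)
  exact le_antisymm (Nat.count_mono_left fun i hi h => by rwa [hword i hi] at h)
    (Nat.count_mono_left fun i hi h => by rwa [hword i hi])

theorem rank_eq_add_add (hdigit : ∀ t i, D.digit t i < D.base) (hs : 0 < D.blockLen)
    (hV : D.superLen < D.radix) {t a p : ℕ} (ha : a < D.width) (hp : p ≤ D.size) :
    D.rank t a p =
      D.superRank ((t * D.superCount + p / D.superLen) * D.width + a) +
        D.blockRankWord (t * D.blockCount + p / D.blockLen) / D.radix ^ a % D.radix +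
        D.blockTable ((D.digitWord (t * D.blockCount + p / D.blockLen) * D.blockLen +
          p % D.blockLen) * D.width + a) := by
  have hblock : p / D.blockLen < D.blockCount := Nat.lt_succ_of_le (Nat.div_le_div_right hp)
  have hsuper : p / D.superLen < D.superCount := Nat.lt_succ_of_le (Nat.div_le_div_right hp)
  rw [superRank_apply hsuper ha, blockRankWord_div_mod hV hblock ha,
    blockTable_digitWord hdigit hblock (Nat.mod_lt p hs) ha, blockRank,
    show p / D.superLen = p / D.blockLen / D.width from (Nat.div_div_eq_div_mul _ _ _).symm,
    Nat.add_sub_cancel' (rank_mono_right t a (superLen_mul_div_le _)), ← rank_add,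
    Nat.div_add_mod]

end RankDirectory

section RadixStep

/-- The remainders modulo `B` of the elements of `Q` with quotient `a`, in their order in `Q`. -/
def bucket (B a : ℕ) (Q : List ℕ) : List ℕ := (Q.filter (· / B = a)).map (· % B)

/-- One round of a stable most-significant-digit radix sort: the elements of `Q` are distributed
into buckets by their leading digit, their quotient by `B`, which is then removed. -/
def radixStep (f B : ℕ) (Q : List ℕ) : List ℕ := (List.range f).flatMap (bucket B · Q)

/-- The position in `radixStep f B Q` at which the elements of bucket `a` that come from positions
of `Q` from `p` on begin. -/
def bucketPos (B : ℕ) (Q : List ℕ) (a p : ℕ) : ℕ :=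
  Q.countP (· / B < a) + (Q.take p).countP (· / B = a)

variable {f B a : ℕ} {Q : List ℕ}

theorem length_bucket (B a : ℕ) (Q : List ℕ) :
    (bucket B a Q).length = Q.countP (· / B = a) := by
  rw [bucket, List.length_map, List.countP_eq_length_filter]

theorem bucket_append (B a : ℕ) (P Q : List ℕ) :
    bucket B a (P ++ Q) = bucket B a P ++ bucket B a Q := by
  rw [bucket, List.filter_append, List.map_append, bucket, bucket]

theorem countP_eq_add_of_iff {α : Type*} {p q r : α → Bool} (L : List α)
    (h : ∀ x ∈ L, p x ↔ q x ∨ r x) (hdisj : ∀ x ∈ L, ¬(q x ∧ r x)) :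
    L.countP p = L.countP q + L.countP r := by
  induction L with
  | nil => rfl
  | cons x L ih =>
    have hx := h x List.mem_cons_self
    have hx' := hdisj x List.mem_cons_self
    rw [List.countP_cons, List.countP_cons, List.countP_cons,
      ih (fun y hy => h y (List.mem_cons_of_mem x hy))
        fun y hy => hdisj y (List.mem_cons_of_mem x hy)]
    split_ifs <;> first | omega | tauto

theorem countP_div_lt_succ (B a : ℕ) (Q : List ℕ) :
    Q.countP (· / B < a + 1) = Q.countP (· / B < a) + Q.countP (· / B = a) :=
  countP_eq_add_of_iff Q (fun q _ => by simpa using Nat.lt_succ_iff_lt_or_eq)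
    (fun q _ => by simp only [decide_eq_true_eq]; omega)

theorem lt_iff_div_lt_or_mod_lt (B q v : ℕ) :
    q < v ↔ q / B < v / B ∨ q / B = v / B ∧ q % B < v % B := by
  have hq := Nat.div_add_mod q B
  have hv := Nat.div_add_mod v B
  constructor
  · intro h
    rcases (Nat.div_le_div_right (c := B) h.le).lt_or_eq with hlt | heq
    · exact .inl hlt
    · rw [heq] at hq
      exact .inr ⟨heq, by omega⟩
  · rintro (hlt | ⟨heq, hlt⟩)
    · exact lt_of_not_ge fun h => hlt.not_ge (Nat.div_le_div_right h)
    · rw [heq] at hq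
      omega

theorem countP_lt_eq_add_bucket (B v : ℕ) (Q : List ℕ) :
    Q.countP (· < v) =
      Q.countP (· / B < v / B) + (bucket B (v / B) Q).countP (· < v % B) := by
  rw [bucket, List.countP_map, List.countP_filter]
  refine countP_eq_add_of_iff Q (fun q _ => ?_) (fun q _ => ?_)
  · simpa [and_comm] using lt_iff_div_lt_or_mod_lt B q v
  · simp only [decide_eq_true_eq, Function.comp_apply, Bool.and_eq_true]
    omega

theorem length_flatMap_bucket_range (B a : ℕ) (Q : List ℕ) :
    ((List.range a).flatMap (bucket B · Q)).length = Q.countP (· / B < a) := by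
  induction a with
  | zero => simp
  | succ a ih =>
    rw [List.range_succ, List.flatMap_append, List.length_append, ih, List.flatMap_singleton,
      length_bucket, countP_div_lt_succ]

theorem length_radixStep (h : ∀ q ∈ Q, q / B < f) : (radixStep f B Q).length = Q.length := by
  rw [radixStep, length_flatMap_bucket_range, List.countP_eq_length]
  simpa using h

theorem lt_of_mem_radixStep (hB : 0 < B) {q : ℕ} (hq : q ∈ radixStep f B Q) : q < B := by
  simp only [radixStep, bucket, List.mem_flatMap, List.mem_map] at hq
  obtain ⟨_, _, r, _, rfl⟩ := hq
  exact Nat.mod_lt _ hB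

theorem extract_radixStep_append (ha : a < f) (P M R : List ℕ) :
    (radixStep f B (P ++ M ++ R)).extract
        ((P ++ M ++ R).countP (· / B < a) + P.countP (· / B = a))
        ((P ++ M ++ R).countP (· / B < a) + (P ++ M).countP (· / B = a)) =
      bucket B a M := by
  obtain ⟨k, rfl⟩ := Nat.exists_eq_add_of_lt ha
  have hrange : List.range (a + k + 1) = List.range a ++ [a] ++ (List.range k).map (a + 1 + ·) := by
    rw [← List.range_succ, ← List.range_add]
    congr 1
    omega
  rw [radixStep, hrange, List.flatMap_append, List.flatMap_append, List.flatMap_singleton,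
    bucket_append, bucket_append, ← length_flatMap_bucket_range, List.countP_append,
    ← length_bucket, ← length_bucket]
  generalize (List.range a).flatMap _ = L
  simp [← Nat.add_assoc]

theorem take_append_extract {α : Type*} (L : List α) {l r : ℕ} (h : l ≤ r) :
    L.take l ++ L.extract l r = L.take r := by
  rw [List.extract_eq_take_drop, ← List.take_add, Nat.add_sub_cancel' h]

theorem extract_radixStep (ha : a < f) {l r : ℕ} (h : l ≤ r) :
    (radixStep f B Q).extract (bucketPos B Q a l) (bucketPos B Q a r) =
      bucket B a (Q.extract l r) := by
  have hQ : Q.take l ++ Q.extract l r ++ Q.drop r = Q := by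
    rw [take_append_extract Q h, List.take_append_drop]
  have hextract := extract_radixStep_append (B := B) ha (Q.take l) (Q.extract l r) (Q.drop r)
  rwa [hQ, take_append_extract Q h] at hextract

theorem countP_lt_extract_eq {v l r : ℕ} (hv : v / B < f) (h : l ≤ r) :
    (Q.extract l r).countP (· < v) =
      (Q.extract l r).countP (· / B < v / B) +
        ((radixStep f B Q).extract (bucketPos B Q (v / B) l) (bucketPos B Q (v / B) r)).countP
          (· < v % B) := by
  rw [extract_radixStep hv h, ← countP_lt_eq_add_bucket]

theorem bucketPos_mono {l r : ℕ} (h : l ≤ r) : bucketPos B Q a l ≤ bucketPos B Q a r :=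
  Nat.add_le_add_left (List.take_sublist_take_left h).countP_le _

theorem bucketPos_le_length (p : ℕ) : bucketPos B Q a p ≤ Q.length := by
  have hprefix : (Q.take p).countP (· / B = a) ≤ Q.countP (· / B = a) :=
    (List.take_sublist p Q).countP_le
  have hsucc := countP_div_lt_succ B a Q
  have htotal : Q.countP (· / B < a + 1) ≤ Q.length := List.countP_le_length
  rw [bucketPos]
  omega

variable {δ : ℕ → ℕ}

theorem count_lt_eq_countP_take (h : ∀ i (hi : i < Q.length), δ i = Q[i] / B) (a : ℕ) {p : ℕ}
    (hp : p ≤ Q.length) : Nat.count (fun i => δ i < a) p = (Q.take p).countP (· / B < a) := by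
  induction p with
  | zero => simp
  | succ p ih =>
    rw [Nat.count_succ, ih (by omega), h p hp, List.take_add_one, List.getElem?_eq_getElem hp,
      List.countP_append]
    simp [List.countP_cons]

end RadixStep

/-- The number of points in columns before `b`. -/
def colCount (S : Finset (ℕ × ℕ)) (b : ℕ) : ℕ := (S.filter fun p => p.1 < b).card

/-- The number of points in rows before `a`. -/
def rowCount (S : Finset (ℕ × ℕ)) (a : ℕ) : ℕ := (S.filter fun p => p.2 < a).card

/-- The number of points in columns before `b` and rows from `a` on. For points below the diagonal
these lie in the triangle between `a` and `b` at the diagonal. -/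
def wedgeCount (S : Finset (ℕ × ℕ)) (b a : ℕ) : ℕ := (S.filter fun p => p.1 < b ∧ a ≤ p.2).card

/-- The boundary of a quadrant with apex in column `x` runs just before column `x + colShift`. -/
def Quadrant.colShift : Quadrant → ℕ
  | .leLe | .leGe => 1
  | .geLe | .geGe => 0

/-- The boundary of a quadrant with apex in row `y` runs just before row `y + rowShift`. -/
def Quadrant.rowShift : Quadrant → ℕ
  | .leLe | .geLe => 1
  | .leGe | .geGe => 0

theorem Quadrant.add_colShift_le {x n : ℕ} (hx : x ≤ n) (Q : Quadrant) :
    x + Q.colShift ≤ n + 1 := by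
  cases Q <;> simp only [Quadrant.colShift] <;> omega

theorem Quadrant.add_rowShift_le {y n : ℕ} (hy : y ≤ n) (Q : Quadrant) :
    y + Q.rowShift ≤ n + 1 := by
  cases Q <;> simp only [Quadrant.rowShift] <;> omega

section Counts

variable (S : Finset (ℕ × ℕ)) (x y : ℕ)

theorem wedgeCount_eq_zero {S : Finset (ℕ × ℕ)} (hS : ∀ p ∈ S, p.2 ≤ p.1) {a b : ℕ}
    (hba : b ≤ a) : wedgeCount S b a = 0 := by
  rw [wedgeCount, Finset.card_eq_zero, Finset.filter_eq_empty_iff]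
  intro p hp
  have := hS p hp
  omega

theorem dominanceCount_leLe_add :
    dominanceCount S x y .leLe + wedgeCount S (x + 1) (y + 1) = colCount S (x + 1) := by
  rw [colCount, ← Finset.card_filter_add_card_filter_not (p := fun p : ℕ × ℕ => p.2 ≤ y)]
  simp only [Finset.filter_filter, dominanceCount, wedgeCount, Nat.lt_succ_iff, Nat.succ_le_iff,
    not_le]

theorem dominanceCount_leGe : dominanceCount S x y .leGe = wedgeCount S (x + 1) y := by
  simp only [dominanceCount, wedgeCount, Nat.lt_succ_iff]

theorem dominanceCount_geLe_add :
    dominanceCount S x y .geLe + colCount S x = rowCount S (y + 1) + wedgeCount S x (y + 1) := by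
  rw [rowCount, colCount, ← Finset.card_filter_add_card_filter_not (s := S.filter (·.2 < y + 1))
    (p := fun p => x ≤ p.1), ← Finset.card_filter_add_card_filter_not (s := S.filter (·.1 < x))
    (p := fun p => p.2 < y + 1)]
  simp only [Finset.filter_filter, dominanceCount, wedgeCount, Nat.lt_succ_iff, Nat.succ_le_iff,
    not_le, and_comm]
  omega

theorem dominanceCount_geGe_add :
    dominanceCount S x y .geGe + wedgeCount S x y + rowCount S y = S.card := by
  rw [rowCount, ← Finset.card_filter_add_card_filter_not (s := S) (p := fun p => p.2 < y),
    ← Finset.card_filter_add_card_filter_not (s := S.filter (¬ ·.2 < y)) (p := fun p => p.1 < x)]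
  simp only [Finset.filter_filter, dominanceCount, wedgeCount, not_lt, and_comm]
  omega

end Counts

/-- The horizontal position of a point relative to its strip. The strips are the blocks of rows
`[q * K, (q + 2) * K)` with `q` of the parity of `π`; positions are cut off at `M - 1`. -/
def blockKey (K π M : ℕ) (p : ℕ × ℕ) : ℕ :=
  min (p.1 - (p.2 / K - (p.2 / K + π) % 2) * K) (M - 1)

theorem blockKey_lt_iff {K M a b : ℕ} {p : ℕ × ℕ} (hab : b - a ≤ K) (hM : 2 * K ≤ M)
    (ha : a ≤ p.2) (hb : p.2 < b) (hp : p.2 ≤ p.1) :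
    blockKey K (a / K % 2) M p < b - a / K * K ↔ p.1 < b := by
  have hK : 0 < K := by omega
  have hlower : a / K * K ≤ a := Nat.div_mul_le_self a K
  have hupper : a < a / K * K + K := Nat.lt_div_mul_add hK
  have hstrip : p.2 / K - (p.2 / K + a / K % 2) % 2 = a / K := by
    have hle : a / K ≤ p.2 / K := Nat.div_le_div_right ha
    have hlt : p.2 / K < a / K + 2 := by
      rw [Nat.div_lt_iff_lt_mul hK, add_mul]
      omega
    generalize a / K = q at hle hlt ⊢
    generalize p.2 / K = q' at hle hlt ⊢
    omega
  rw [blockKey, hstrip]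
  omega

theorem take_countP_lt_eq_filter {α : Type*} (key : α → ℕ) (b : ℕ) {L : List α}
    (hL : L.Pairwise (key · ≤ key ·)) : L.take (L.countP (key · < b)) = L.filter (key · < b) := by
  induction L with
  | nil => rfl
  | cons p L ih =>
    rw [List.pairwise_cons] at hL
    by_cases hp : key p < b
    · simp [hp, ih hL.2]
    · have hempty : ∀ q ∈ p :: L, ¬key q < b := by
        rintro q (_ | ⟨_, hq⟩)
        exacts [hp, fun h => hp ((hL.1 q hq).trans_lt h)]
      rw [List.filter_eq_nil_iff.2 (by simpa using hempty),
        List.countP_eq_zero.2 (by simpa using hempty), List.take_zero]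

theorem countP_extract_countP_lt {α : Type*} (key : α → ℕ) (P : α → Prop) [DecidablePred P]
    {a b : ℕ} (hab : a ≤ b) {L : List α} (hL : L.Pairwise (key · ≤ key ·)) :
    (L.extract (L.countP (key · < a)) (L.countP (key · < b))).countP P =
      L.countP fun p => P p ∧ a ≤ key p ∧ key p < b := by
  have hle : L.countP (key · < a) ≤ L.countP (key · < b) :=
    List.countP_mono_left fun p _ hp => by
      simp only [decide_eq_true_eq] at hp ⊢
      omega
  have htake := congrArg (List.countP P) (take_append_extract L hle)
  rw [List.countP_append, take_countP_lt_eq_filter key a hL, take_countP_lt_eq_filter key b hL,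
    List.countP_filter, List.countP_filter] at htake
  have hsplit : L.countP (fun p => P p ∧ key p < b) =
      L.countP (fun p => P p ∧ key p < a) + L.countP (fun p => P p ∧ a ≤ key p ∧ key p < b) := by
    refine countP_eq_add_of_iff L (fun p _ => ?_) fun p _ => ?_ <;>
      simp only [decide_eq_true_eq] <;> grind
  simp only [Bool.decide_and] at hsplit ⊢
  omega

/-- The points of `S` in the order of their rows. -/
noncomputable def pointsByRow (S : Finset (ℕ × ℕ)) : List (ℕ × ℕ) :=
  S.toList.mergeSort (·.2 ≤ ·.2)

theorem pairwise_pointsByRow (S : Finset (ℕ × ℕ)) :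
    (pointsByRow S).Pairwise (·.2 ≤ ·.2) := by
  have h : (pointsByRow S).Pairwise fun p q => decide (p.2 ≤ q.2) = true :=
    List.pairwise_mergeSort
      (fun p q r => by simpa only [decide_eq_true_eq] using le_trans)
      (fun p q => by simpa only [Bool.or_eq_true, decide_eq_true_eq] using le_total p.2 q.2) _
  exact h.imp of_decide_eq_true

theorem mem_pointsByRow {S : Finset (ℕ × ℕ)} {p : ℕ × ℕ} : p ∈ pointsByRow S ↔ p ∈ S := by
  rw [pointsByRow, List.mem_mergeSort, Finset.mem_toList]

theorem length_pointsByRow (S : Finset (ℕ × ℕ)) : (pointsByRow S).length = S.card := by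
  rw [pointsByRow, List.length_mergeSort, Finset.length_toList]

theorem countP_pointsByRow (S : Finset (ℕ × ℕ)) (P : ℕ × ℕ → Prop) [DecidablePred P] :
    (pointsByRow S).countP P = (S.filter P).card := by
  rw [pointsByRow, (List.mergeSort_perm _ _).countP_eq, ← Multiset.coe_countP, Finset.coe_toList,
    Multiset.countP_eq_card_filter]
  rfl

theorem countP_blockKey_extract {S : Finset (ℕ × ℕ)} (hS : ∀ p ∈ S, p.2 ≤ p.1) {K M a b : ℕ}
    (hlt : a < b) (hab : b - a ≤ K) (hM : 2 * K ≤ M) :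
    (((pointsByRow S).map (blockKey K (a / K % 2) M)).extract (rowCount S a)
      (rowCount S b)).countP (· < b - a / K * K) = wedgeCount S b a := by
  have hrow (i : ℕ) : rowCount S i = (pointsByRow S).countP (·.2 < i) :=
    (countP_pointsByRow S _).symm
  rw [List.extract_eq_take_drop, ← List.map_drop, ← List.map_take, ← List.extract_eq_take_drop,
    List.countP_map, hrow, hrow]
  refine (countP_extract_countP_lt Prod.snd (fun p => blockKey K (a / K % 2) M p < b - a / K * K)
    hlt.le (pairwise_pointsByRow S)).trans ?_
  rw [wedgeCount, ← countP_pointsByRow]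
  refine List.countP_congr fun p hp => ?_
  have hp := hS p (mem_pointsByRow.1 hp)
  have hkey := blockKey_lt_iff (p := p) hab hM
  simp only [decide_eq_true_eq]
  constructor
  · rintro ⟨h, ha, hb⟩
    exact ⟨(hkey ha hb hp).1 h, ha⟩
  · rintro ⟨hb, ha⟩
    exact ⟨(hkey ha (hp.trans_lt hb) hp).2 hb, ha, hp.trans_lt hb⟩

/-- The contents of the dominance counting structure: rank structures, numbers `rowStart`,
`colStart` of points before a given row or column, and for each span `d = 0, 1, …` of a query the
height `strip d` of a strip of rows together with the number `start d` of the first digit sequence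
and the number `depth d` of digits of the keys that it uses. The leading digit of a number coded
from sequence `t` on has weight `unit t`. -/
structure Index extends RankDirectory where
  unit : ℕ → ℕ
  rowStart : ℕ → ℕ
  colStart : ℕ → ℕ
  strip : ℕ → ℕ
  start : ℕ → ℕ
  depth : ℕ → ℕ

namespace Index

open WordRAM RankDirectory

/-- The tables that are kept in memory. Single numbers are stored as constant tables. -/
inductive Table where
  | size | base | width | blockLen | superLen | radix | blockCount | superCount
  | blockTable | digitWord | superRank | blockRankWord | radixPow
  | unit | rowStart | colStart | strip | start | depth
  deriving DecidableEq

/-- The number of constructors of `Table`. -/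
def tableCount : ℕ := 19

theorem Table.ctorIdx_lt (F : Table) : F.ctorIdx < tableCount := by cases F <;> decide

/-- The expression that reads entry `e` of the table. -/
def Table.read (F : Table) (e : Expr) : Expr := readEntry tableCount F.ctorIdx e

/-- The expression that reads the value of a constant table. -/
def Table.const (F : Table) : Expr := F.read 0

variable (X : Index)

/-- The entries of the tables. -/
def value : Table → ℕ → ℕ
  | .size, _ => X.size
  | .base, _ => X.base
  | .width, _ => X.width
  | .blockLen, _ => X.blockLen
  | .superLen, _ => X.superLen
  | .radix, _ => X.radix
  | .blockCount, _ => X.blockCount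
  | .superCount, _ => X.superCount
  | .blockTable, i => X.blockTable i
  | .digitWord, i => X.digitWord i
  | .superRank, i => X.superRank i
  | .blockRankWord, i => X.blockRankWord i
  | .radixPow, i => X.radix ^ i
  | .unit, i => X.unit i
  | .rowStart, i => X.rowStart i
  | .colStart, i => X.colStart i
  | .strip, i => X.strip i
  | .start, i => X.start i
  | .depth, i => X.depth i

/-- The memory with `Z` entries of every table. -/
def memory (w Z : ℕ) : List (BitVec w) :=
  interleave w tableCount Z fun r => X.value (Table.ofNat r)

/-- The rank structures for `T` digit sequences fit into tables of `Z` words of `w` bits. -/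
structure Fits (w Z T : ℕ) : Prop where
  addr_le : tableCount * (Z + 1) ≤ 2 ^ w
  one_lt_base : 1 < X.base
  blockLen_pos : 0 < X.blockLen
  superLen_lt : X.superLen < X.radix
  digit_lt : ∀ t i, X.digit t i < X.base
  size_le : X.size ≤ Z
  blockTable_le : X.base ^ X.blockLen * X.blockLen * X.width ≤ Z
  radix_pow_le : X.radix ^ X.width ≤ Z
  blockCount_le : T * X.blockCount ≤ Z
  superCount_le : T * X.superCount * X.width ≤ Z
  unit_le : ∀ t < T, X.unit t ≤ Z

/-- The expression for the rank of digit bound `a` at position `p` of sequence `t`. -/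
def rankExpr (t a p : Expr) : Expr :=
  Table.superRank.read
      ((t * Table.superCount.const + p / Table.superLen.const) * Table.width.const + a) +
    Table.blockRankWord.read (t * Table.blockCount.const + p / Table.blockLen.const) /
      Table.radixPow.read a % Table.radix.const +
    Table.blockTable.read
      ((Table.digitWord.read (t * Table.blockCount.const + p / Table.blockLen.const) *
        Table.blockLen.const + p % Table.blockLen.const) * Table.width.const + a)

namespace Fits

variable {X} {w Z T : ℕ} (h : X.Fits w Z T)

include h

theorem lt_two_pow {v : ℕ} (hv : v ≤ 2 * Z + 2) : v < 2 ^ w := by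
  have := h.addr_le
  rw [tableCount] at this
  omega

theorem superLen_pos : 0 < X.superLen := Nat.mul_pos h.blockLen_pos (Nat.succ_pos _)

theorem radix_le : X.radix ≤ Z :=
  (Nat.le_self_pow (Nat.succ_ne_zero _) _).trans h.radix_pow_le

theorem base_pow_le : X.base ^ X.blockLen ≤ Z := by
  refine le_trans ?_ h.blockTable_le
  rw [mul_assoc]
  exact Nat.le_mul_of_pos_right _ h.superLen_pos

theorem superLen_le : X.superLen ≤ Z := h.superLen_lt.le.trans h.radix_le

theorem blockLen_le : X.blockLen ≤ Z :=
  (Nat.le_mul_of_pos_right _ (Nat.succ_pos _)).trans h.superLen_le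

theorem width_le : X.width ≤ Z := (Nat.le_mul_of_pos_left _ h.blockLen_pos).trans h.superLen_le

theorem read (F : Table) {ρ : ℕ → ℕ} {e : Expr} {j : ℕ}
    (he : Evaluates (X.memory w Z) ρ e j) (hj : j < Z) (hv : X.value F j ≤ Z) :
    Evaluates (X.memory w Z) ρ (F.read e) (X.value F j) := by
  have hv' : X.value (Table.ofNat F.ctorIdx) j < 2 ^ w := by
    rw [Table.ofNat_ctorIdx]
    exact h.lt_two_pow (by omega)
  have hread := he.readEntry F.ctorIdx_lt hj h.addr_le hv'
  rwa [Table.ofNat_ctorIdx] at hread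

theorem const (F : Table) {ρ : ℕ → ℕ} (hv : X.value F 0 ≤ Z) :
    Evaluates (X.memory w Z) ρ F.const (X.value F 0) :=
  h.read F (Evaluates.lit (h.lt_two_pow (Nat.zero_le _))) (h.superLen_pos.trans_le h.superLen_le) hv

section Rank

variable {ρ : ℕ → ℕ} {et ea ep : Expr} {t a p : ℕ} (ht : Evaluates (X.memory w Z) ρ et t)
  (ha : Evaluates (X.memory w Z) ρ ea a) (hp : Evaluates (X.memory w Z) ρ ep p) (htT : t < T)
  (ha_lt : a < X.width) (hp_le : p ≤ X.size)

include ht hp htT hp_le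

theorem evaluates_blockIndex :
    t * X.blockCount + p / X.blockLen < Z ∧
      Evaluates (X.memory w Z) ρ (et * Table.blockCount.const + ep / Table.blockLen.const)
        (t * X.blockCount + p / X.blockLen) := by
  have hq : p / X.blockLen < X.blockCount := Nat.lt_succ_of_le (Nat.div_le_div_right hp_le)
  have hentry := (mul_add_lt_mul htT hq).trans_le h.blockCount_le
  have hcount : X.blockCount ≤ Z :=
    (Nat.le_mul_of_pos_left _ (Nat.zero_lt_of_lt htT)).trans h.blockCount_le
  exact ⟨hentry, ht.mul_add (h.const .blockCount hcount)
    (hp.div (h.const .blockLen h.blockLen_le)) (h.lt_two_pow (hentry.le.trans (by omega)))⟩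

include ha ha_lt

theorem evaluates_superRank :
    Evaluates (X.memory w Z) ρ
      (Table.superRank.read
        ((et * Table.superCount.const + ep / Table.superLen.const) * Table.width.const + ea))
      (X.superRank ((t * X.superCount + p / X.superLen) * X.width + a)) := by
  have hq : p / X.superLen < X.superCount := Nat.lt_succ_of_le (Nat.div_le_div_right hp_le)
  have hrow := mul_add_lt_mul htT hq
  have hentry := (mul_add_lt_mul hrow ha_lt).trans_le h.superCount_le
  have hrow_le := (Nat.le_mul_of_pos_right (T * X.superCount) (Nat.succ_pos X.base)).trans
    h.superCount_le
  have hcount : X.superCount ≤ Z :=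
    (Nat.le_mul_of_pos_left _ (Nat.zero_lt_of_lt htT)).trans hrow_le
  refine h.read .superRank ?_ hentry ?_
  · exact ((ht.mul_add (h.const .superCount hcount) (hp.div (h.const .superLen h.superLen_le))
      (h.lt_two_pow (hrow.le.trans (by omega)))).mul_add (h.const .width h.width_le) ha
      (h.lt_two_pow (by exact hentry.le.trans (by omega))))
  · have := X.superRank_apply (t := t) hq ha_lt
    have := (X.rank_le t a _).trans (Nat.mul_div_le p X.superLen)
    have := h.size_le
    simp only [value]
    omega

theorem evaluates_blockRank :
    Evaluates (X.memory w Z) ρ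
      (Table.blockRankWord.read (et * Table.blockCount.const + ep / Table.blockLen.const) /
        Table.radixPow.read ea % Table.radix.const)
      (X.blockRankWord (t * X.blockCount + p / X.blockLen) / X.radix ^ a % X.radix) := by
  obtain ⟨hlt, hindex⟩ := h.evaluates_blockIndex ht hp htT hp_le
  have hradix : 1 < X.radix := Nat.lt_of_le_of_lt h.superLen_pos h.superLen_lt
  have hword (i : ℕ) : X.blockRankWord i < X.radix ^ X.width :=
    packDigits_lt hradix (fun _ => (blockRank_le _ _ _).trans_lt h.superLen_lt) _
  have hpow : X.radix ^ a ≤ Z :=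
    (Nat.pow_le_pow_right hradix.le ha_lt.le).trans h.radix_pow_le
  refine ((h.read .blockRankWord hindex hlt ?_).div
    (h.read .radixPow ha (ha_lt.trans_le h.width_le) hpow)).mod (h.const .radix h.radix_le)
  exact (hword _).le.trans h.radix_pow_le

theorem evaluates_blockTable :
    Evaluates (X.memory w Z) ρ
      (Table.blockTable.read
        ((Table.digitWord.read (et * Table.blockCount.const + ep / Table.blockLen.const) *
          Table.blockLen.const + ep % Table.blockLen.const) * Table.width.const + ea))
      (X.blockTable ((X.digitWord (t * X.blockCount + p / X.blockLen) * X.blockLen +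
        p % X.blockLen) * X.width + a)) := by
  obtain ⟨hlt, hindex⟩ := h.evaluates_blockIndex ht hp htT hp_le
  set i := t * X.blockCount + p / X.blockLen
  have hword : X.digitWord i < X.base ^ X.blockLen :=
    packDigits_lt h.one_lt_base (fun _ => h.digit_lt _ _) _
  have hrow := mul_add_lt_mul hword (Nat.mod_lt p h.blockLen_pos)
  have hentry := (mul_add_lt_mul hrow ha_lt).trans_le h.blockTable_le
  have hrow_lt := hrow.trans_le
    ((Nat.le_mul_of_pos_right _ (Nat.succ_pos X.base)).trans h.blockTable_le)
  have hblockLen := h.const (ρ := ρ) .blockLen h.blockLen_le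
  refine h.read .blockTable ((((h.read .digitWord hindex hlt ?_).mul_add hblockLen
    (hp.mod hblockLen) (h.lt_two_pow ?_)).mul_add (h.const .width h.width_le) ha
    (h.lt_two_pow ?_))) hentry ?_
  · exact hword.le.trans h.base_pow_le
  · exact hrow_lt.le.trans (by omega)
  · exact hentry.le.trans (by omega)
  · exact ((Nat.count_le _).trans (Nat.mod_lt _ h.blockLen_pos).le).trans h.blockLen_le

theorem evaluates_rankExpr :
    Evaluates (X.memory w Z) ρ (rankExpr et ea ep) (X.rank t a p) := by
  have hsplit := X.rank_eq_add_add h.digit_lt h.blockLen_pos h.superLen_lt (t := t) ha_lt hp_le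
  have hlt : X.rank t a p < 2 ^ w :=
    h.lt_two_pow (((rank_le t a p).trans (hp_le.trans h.size_le)).trans (by omega))
  have hparts := ((h.evaluates_superRank ht ha hp htT ha_lt hp_le).add
    (h.evaluates_blockRank ht ha hp htT ha_lt hp_le) (by omega)).add
    (h.evaluates_blockTable ht ha hp htT ha_lt hp_le) (by omega)
  exact hparts.congr hsplit.symm

end Rank

end Fits

/-- The expression for the position in the next list of the radix sort at which the current bucket,
restricted to the positions from `p` on, begins. -/
def bucketPosExpr (t a p : Expr) : Expr :=
  rankExpr t a Table.size.const + (rankExpr t (a + 1) p - rankExpr t a p)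

/-- The digit sequences `t, t + 2, …` hold the digits of the `m`-digit numbers in `L`, sorted by
their more significant digits. -/
def Codes (X : Index) (T : ℕ) : ℕ → ℕ → List ℕ → Prop
  | 0, _, _ => True
  | m + 1, t, L => t < T ∧ X.unit t = X.base ^ m ∧
      (∀ i (hi : i < L.length), X.digit t i = L[i] / X.base ^ m) ∧
      Codes X T m (t + 2) (radixStep X.base (X.base ^ m) L)

section Codes

variable {X : Index} {t B : ℕ} {L : List ℕ} (hL : L.length = X.size)
  (hdigit : ∀ i (hi : i < L.length), X.digit t i = L[i] / B)

include hL hdigit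

theorem rank_eq_countP_take (a : ℕ) {p : ℕ} (hp : p ≤ X.size) :
    X.rank t a p = (L.take p).countP (· / B < a) :=
  count_lt_eq_countP_take hdigit a (hL ▸ hp)

theorem rank_add_rank_sub_rank_eq_bucketPos (a : ℕ) {p : ℕ} (hp : p ≤ X.size) :
    X.rank t a X.size + (X.rank t (a + 1) p - X.rank t a p) = bucketPos B L a p := by
  rw [rank_eq_countP_take hL hdigit _ le_rfl, rank_eq_countP_take hL hdigit _ hp,
    rank_eq_countP_take hL hdigit _ hp, countP_div_lt_succ, Nat.add_sub_cancel_left, ← hL,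
    List.take_length, bucketPos]

theorem rank_add_countP_extract (a : ℕ) {l r : ℕ} (hlr : l ≤ r) (hr : r ≤ X.size) :
    X.rank t a l + (L.extract l r).countP (· / B < a) = X.rank t a r := by
  rw [rank_eq_countP_take hL hdigit _ hr, rank_eq_countP_take hL hdigit _ (hlr.trans hr),
    ← take_append_extract L hlr, List.countP_append]

end Codes

theorem Fits.evaluates_bucketPosExpr {X : Index} {w Z T : ℕ} (h : X.Fits w Z T) {ρ : ℕ → ℕ}
    {et ea ep : Expr} {t a p B : ℕ} {L : List ℕ} (hL : L.length = X.size)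
    (hdigit : ∀ i (hi : i < L.length), X.digit t i = L[i] / B)
    (ht : Evaluates (X.memory w Z) ρ et t) (ha : Evaluates (X.memory w Z) ρ ea a)
    (hp : Evaluates (X.memory w Z) ρ ep p) (htT : t < T) (ha_lt : a < X.base)
    (hp_le : p ≤ X.size) :
    Evaluates (X.memory w Z) ρ (bucketPosExpr et ea ep) (bucketPos B L a p) := by
  have hwidth := h.width_le
  have hpos := bucketPos_le_length (B := B) (Q := L) (a := a) p
  have hsize := h.size_le
  have heq := rank_add_rank_sub_rank_eq_bucketPos hL hdigit a hp_le
  rw [width] at hwidth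
  refine (((h.evaluates_rankExpr ht ha (h.const .size hsize) htT (Nat.lt_succ_of_lt ha_lt)
    le_rfl).add ((h.evaluates_rankExpr ht (ha.add (Evaluates.lit (h.lt_two_pow ?_))
      (h.lt_two_pow ?_)) hp htT (Nat.succ_lt_succ ha_lt) hp_le).sub
    (h.evaluates_rankExpr ht ha hp htT (Nat.lt_succ_of_lt ha_lt) hp_le)
      (rank_mono_left t p (Nat.le_succ a)))
    (h.lt_two_pow ?_))).congr heq
  · omega
  · omega
  · exact heq.trans_le (hpos.trans (by omega))

local infix:52 " ::= " => Prog.assign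

local infixr:51 " ;; " => Prog.seq

namespace Reg

abbrev colCut : ℕ := 0
abbrev rowCut : ℕ := 1
abbrev span : ℕ := 2
abbrev strip : ℕ := 3
abbrev bound : ℕ := 4
abbrev seq : ℕ := 5
abbrev remaining : ℕ := 6
abbrev left : ℕ := 7
abbrev right : ℕ := 8
abbrev count : ℕ := 9
abbrev digit : ℕ := 10

end Reg

/-- One round of counting the keys below `bound` between positions `left` and `right`: the keys with
a smaller leading digit are counted, those with the same leading digit are left to the next
round. -/
def roundProg : Prog :=
  Reg.digit ::= .reg Reg.bound / Table.unit.read (.reg Reg.seq) ;;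
  Reg.count ::= .reg Reg.count + rankExpr (.reg Reg.seq) (.reg Reg.digit) (.reg Reg.right) -
    rankExpr (.reg Reg.seq) (.reg Reg.digit) (.reg Reg.left) ;;
  Reg.left ::= bucketPosExpr (.reg Reg.seq) (.reg Reg.digit) (.reg Reg.left) ;;
  Reg.right ::= bucketPosExpr (.reg Reg.seq) (.reg Reg.digit) (.reg Reg.right) ;;
  Reg.bound ::= .reg Reg.bound % Table.unit.read (.reg Reg.seq) ;;
  Reg.seq ::= .reg Reg.seq + 2 ;;
  Reg.remaining ::= .reg Reg.remaining - 1

/-- A state of the counting of keys with `m` digits left: `c` keys have been counted, and the keys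
below `v` between the positions `l` and `r` of the list `L`, which is coded from sequence `t` on,
are still to be counted, to give `total`. -/
structure Descent (X : Index) (T total m t v l r c : ℕ) (L : List ℕ) : Prop where
  length_eq : L.length = X.size
  codes : X.Codes T m t L
  lt_pow : ∀ q ∈ L, q < X.base ^ m
  bound_lt : v < X.base ^ m
  left_le_right : l ≤ r
  right_le : r ≤ X.size
  count_add : c + (L.extract l r).countP (· < v) = total

namespace Descent

variable {X : Index} {T total m t v l r c : ℕ} {L : List ℕ}

theorem count_eq (hd : Descent X T total 0 t v l r c L) : c = total := by
  have hbound : v = 0 := by simpa using hd.bound_lt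
  simpa [hbound] using hd.count_add

theorem div_lt_base (hd : Descent X T total (m + 1) t v l r c L) : v / X.base ^ m < X.base :=
  Nat.div_lt_of_lt_mul (by rw [← pow_succ]; exact hd.bound_lt)

theorem step {a : ℕ} (hbase : 0 < X.base) (hd : Descent X T total (m + 1) t v l r c L)
    (ha : v / X.base ^ m = a) :
    Descent X T total m (t + 2) (v % X.base ^ m) (bucketPos (X.base ^ m) L a l)
      (bucketPos (X.base ^ m) L a r) (c + X.rank t a r - X.rank t a l)
      (radixStep X.base (X.base ^ m) L) := by
  subst ha
  obtain ⟨-, -, hdigit, hcodes⟩ := hd.codes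
  have hB : 0 < X.base ^ m := pow_pos hbase m
  have hlt (q : ℕ) (hq : q ∈ L) : q / X.base ^ m < X.base :=
    Nat.div_lt_of_lt_mul (by rw [← pow_succ]; exact hd.lt_pow q hq)
  refine ⟨(length_radixStep hlt).trans hd.length_eq, hcodes, fun q => lt_of_mem_radixStep hB,
    Nat.mod_lt _ hB, bucketPos_mono hd.left_le_right,
    (bucketPos_le_length _).trans_eq hd.length_eq, ?_⟩
  have hcount := hd.count_add
  rw [countP_lt_extract_eq hd.div_lt_base hd.left_le_right] at hcount
  rw [← rank_add_countP_extract hd.length_eq hdigit _ hd.left_le_right hd.right_le]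
  omega

end Descent

/-- The state of the counting, as held in the registers of `roundProg`; the query `b`, `a` is kept
for later use. -/
def InDescent (X : Index) (T total b a m : ℕ) (ρ : ℕ → ℕ) : Prop :=
  (∃ L, Descent X T total m (ρ Reg.seq) (ρ Reg.bound) (ρ Reg.left) (ρ Reg.right) (ρ Reg.count) L) ∧
    ρ Reg.remaining = m ∧ ρ Reg.colCut = b ∧ ρ Reg.rowCut = a

theorem Fits.runs_roundProg {X : Index} {w Z T total b a m : ℕ} {ρ : ℕ → ℕ} (h : X.Fits w Z T)
    (htotal : total ≤ X.size) (hρ : X.InDescent T total b a (m + 1) ρ) :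
    Runs (X.memory w Z) roundProg ρ roundProg.baseCost (X.InDescent T total b a m) := by
  obtain ⟨⟨L, hd⟩, hremaining, hb, ha⟩ := hρ
  obtain ⟨htT, hunit, hdigit, -⟩ := hd.codes
  have hTZ : T ≤ Z := (Nat.le_mul_of_pos_right T (Nat.succ_pos _)).trans h.blockCount_le
  have hsize := h.size_le
  have hlr := hd.left_le_right
  have hright := hd.right_le
  have hleft := hlr.trans hright
  have hlt := hd.div_lt_base
  have hlt' := Nat.lt_succ_of_lt hlt
  have hcount_le := Nat.le.intro hd.count_add
  have hrank := rank_mono_right (D := X.toRankDirectory) (ρ Reg.seq) (ρ Reg.bound / X.base ^ m) hlr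
  have hrank_le := rank_le (D := X.toRankDirectory) (ρ Reg.seq) (ρ Reg.bound / X.base ^ m)
    (ρ Reg.right)
  have reg {ρ' : ℕ → ℕ} (r : ℕ) := Evaluates.reg (μ := X.memory w Z) (ρ := ρ') r
  have lit {ρ' : ℕ → ℕ} {k : ℕ} (hk : k ≤ 2) :=
    Evaluates.lit (μ := X.memory w Z) (ρ := ρ') (h.lt_two_pow (v := k) (by omega))
  have unit {ρ' : ℕ → ℕ} (ht : ρ' Reg.seq = ρ Reg.seq) :=
    (h.read .unit (ρ := ρ') ((reg Reg.seq).congr ht) (htT.trans_le hTZ) (h.unit_le _ htT)).congr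
      hunit
  refine Runs.assign_seq ((reg Reg.bound).div (unit rfl)) ?_
  let ρ₁ := Function.update ρ Reg.digit (ρ Reg.bound / X.base ^ m)
  have rank (r : ℕ) (hr : ρ₁ r ≤ X.size) :=
    h.evaluates_rankExpr (ρ := ρ₁) (reg Reg.seq) (reg Reg.digit) (reg r) htT hlt' hr
  refine Runs.assign_seq (((reg Reg.count).add (rank Reg.right hright) (h.lt_two_pow ?_)).sub
    (rank Reg.left hleft) (hrank.trans (Nat.le_add_left _ _))) ?_
  · change ρ Reg.count + X.rank (ρ Reg.seq) (ρ Reg.bound / X.base ^ m) (ρ Reg.right) ≤ _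
    omega
  refine Runs.assign_seq (h.evaluates_bucketPosExpr hd.length_eq hdigit (reg Reg.seq)
    (reg Reg.digit) (reg Reg.left) htT hlt hleft) ?_
  refine Runs.assign_seq (h.evaluates_bucketPosExpr hd.length_eq hdigit (reg Reg.seq)
    (reg Reg.digit) (reg Reg.right) htT hlt hright) ?_
  refine Runs.assign_seq ((reg Reg.bound).mod (unit rfl)) ?_
  refine Runs.assign_seq ((reg Reg.seq).add (lit le_rfl) (h.lt_two_pow ?_)) ?_
  · change ρ Reg.seq + 2 ≤ _
    omega
  exact Runs.assign ((reg Reg.remaining).sub (lit one_le_two)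
    ((Nat.le_add_left 1 m).trans_eq hremaining.symm))
    ⟨⟨_, hd.step (Nat.zero_lt_of_lt h.one_lt_base) rfl⟩, Nat.sub_eq_of_eq_add hremaining, hb, ha⟩

/-- The program that, for cuts `b` and `a` with `a < b`, finds the strip of rows and the digit
sequences that serve the points between `a` and `b`. -/
def setupProg : Prog :=
  Reg.span ::= .reg Reg.colCut - .reg Reg.rowCut ;;
  Reg.strip ::= Table.strip.read (.reg Reg.span) ;;
  Reg.bound ::= .reg Reg.colCut - .reg Reg.rowCut / .reg Reg.strip * .reg Reg.strip ;;
  Reg.seq ::= Table.start.read (.reg Reg.span) + .reg Reg.rowCut / .reg Reg.strip % 2 ;;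
  Reg.remaining ::= Table.depth.read (.reg Reg.span) ;;
  Reg.left ::= Table.rowStart.read (.reg Reg.rowCut) ;;
  Reg.right ::= Table.rowStart.read (.reg Reg.colCut)

/-- The program that counts the points in columns before `colCut` and rows from `rowCut` on. -/
def wedgeProg : Prog :=
  .ite (.bin .lt (.reg Reg.rowCut) (.reg Reg.colCut))
    (setupProg ;; .loop (.reg Reg.remaining) roundProg) .skip

/-- The number of points in a quadrant, by inclusion and exclusion. -/
def answerExpr : Quadrant → Expr
  | .leLe => Table.colStart.read (.reg Reg.colCut) - .reg Reg.count
  | .leGe => .reg Reg.count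
  | .geLe => Table.rowStart.read (.reg Reg.rowCut) + .reg Reg.count -
      Table.colStart.read (.reg Reg.colCut)
  | .geGe => Table.size.const - Table.rowStart.read (.reg Reg.rowCut) - .reg Reg.count

/-- The program for quadrants of kind `Q`, started with the apex `(x, y)` in the first two
registers. -/
def queryProg (Q : Quadrant) : Prog :=
  Reg.colCut ::= .reg Reg.colCut + .lit Q.colShift ;;
  Reg.rowCut ::= .reg Reg.rowCut + .lit Q.rowShift ;;
  wedgeProg ;;
  Reg.colCut ::= answerExpr Q

/-- The time of one iteration of the loop in `wedgeProg`. -/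
def iterationCost : ℕ := (Expr.reg Reg.remaining).cost + 1 + roundProg.baseCost

/-- The index is a dominance counting structure for `S`, for cuts up to `n + 1`. -/
structure Represents (X : Index) (Z T n : ℕ) (S : Finset (ℕ × ℕ)) : Prop where
  succ_lt : n + 1 < Z
  size_eq : X.size = S.card
  rowStart_eq : ∀ i ≤ n + 1, X.rowStart i = rowCount S i
  colStart_eq : ∀ i ≤ n + 1, X.colStart i = colCount S i
  strip_le : ∀ d ≤ n + 1, X.strip d ≤ Z
  start_lt : ∀ d ≤ n + 1, X.start d < Z
  depth_le : ∀ d ≤ n + 1, X.depth d ≤ Z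
  exists_descent : ∀ a b, a < b → b ≤ n + 1 →
    ∃ L, X.Descent T (wedgeCount S b a) (X.depth (b - a))
      (X.start (b - a) + a / X.strip (b - a) % 2) (b - a / X.strip (b - a) * X.strip (b - a))
      (X.rowStart a) (X.rowStart b) 0 L

namespace Represents

variable {X : Index} {w Z T n : ℕ} {S : Finset (ℕ × ℕ)} (hX : X.Represents Z T n S)
  (h : X.Fits w Z T)

include hX

theorem card_le (h : X.Fits w Z T) : S.card ≤ Z := hX.size_eq.symm.trans_le h.size_le

theorem rowStart_le (h : X.Fits w Z T) {i : ℕ} (hi : i ≤ n + 1) : X.rowStart i ≤ Z :=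
  (hX.rowStart_eq i hi).trans_le ((Finset.card_filter_le _ _).trans (hX.card_le h))

theorem colStart_le (h : X.Fits w Z T) {i : ℕ} (hi : i ≤ n + 1) : X.colStart i ≤ Z :=
  (hX.colStart_eq i hi).trans_le ((Finset.card_filter_le _ _).trans (hX.card_le h))

include h

theorem runs_setupProg {ρ : ℕ → ℕ} (hcount : ρ Reg.count = 0) (hlt : ρ Reg.rowCut < ρ Reg.colCut)
    (hle : ρ Reg.colCut ≤ n + 1) :
    Runs (X.memory w Z) setupProg ρ setupProg.baseCost
      (X.InDescent T (wedgeCount S (ρ Reg.colCut) (ρ Reg.rowCut)) (ρ Reg.colCut) (ρ Reg.rowCut)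
        (X.depth (ρ Reg.colCut - ρ Reg.rowCut))) := by
  set b := ρ Reg.colCut
  set a := ρ Reg.rowCut
  have hn := hX.succ_lt
  have hspan : b - a ≤ n + 1 := (Nat.sub_le b a).trans hle
  have hstart := hX.start_lt _ hspan
  have hstrip := hX.strip_le _ hspan
  have hblock : a / X.strip (b - a) * X.strip (b - a) ≤ a := Nat.div_mul_le_self _ _
  have reg {ρ' : ℕ → ℕ} (r : ℕ) := Evaluates.reg (μ := X.memory w Z) (ρ := ρ') r
  have lit {ρ' : ℕ → ℕ} := Evaluates.lit (μ := X.memory w Z) (ρ := ρ') (k := 2)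
    (h.lt_two_pow (by omega))
  obtain ⟨L, hL⟩ := hX.exists_descent a b hlt hle
  refine Runs.assign_seq ((reg Reg.colCut).sub (reg Reg.rowCut) hlt.le) ?_
  refine Runs.assign_seq (h.read .strip (reg Reg.span) (hspan.trans_lt hn) hstrip) ?_
  refine Runs.assign_seq ((reg Reg.colCut).sub (((reg Reg.rowCut).div (reg Reg.strip)).mul
    (reg Reg.strip) (h.lt_two_pow ?_)) ?_) ?_
  · exact hblock.trans (by omega)
  · exact hblock.trans hlt.le
  refine Runs.assign_seq ((h.read .start (reg Reg.span) (hspan.trans_lt hn) ?_).add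
    (((reg Reg.rowCut).div (reg Reg.strip)).mod lit) (h.lt_two_pow ?_)) ?_
  · exact hstart.le
  · have := Nat.mod_lt (a / X.strip (b - a)) two_pos
    change X.start (b - a) + a / X.strip (b - a) % 2 ≤ _
    omega
  refine Runs.assign_seq (h.read .depth (reg Reg.span) (hspan.trans_lt hn)
    (hX.depth_le _ hspan)) ?_
  refine Runs.assign_seq (h.read .rowStart (reg Reg.rowCut) ((hlt.le.trans hle).trans_lt hn)
    (hX.rowStart_le h (hlt.le.trans hle))) ?_
  refine Runs.assign (h.read .rowStart (reg Reg.colCut) (hle.trans_lt hn)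
    (hX.rowStart_le h hle)) ⟨⟨L, ?_⟩, rfl, rfl, rfl⟩
  change X.Descent T _ _ _ _ _ _ (ρ Reg.count) L
  rwa [hcount]

theorem runs_wedgeProg (hS : ∀ p ∈ S, p.2 ≤ p.1) {ρ : ℕ → ℕ} {a b : ℕ}
    (hb : ρ Reg.colCut = b) (ha : ρ Reg.rowCut = a) (hcount : ρ Reg.count = 0)
    (hle : b ≤ n + 1) :
    Runs (X.memory w Z) wedgeProg ρ (wedgeProg.baseCost + X.depth (b - a) * iterationCost)
      fun ρ' => ρ' Reg.colCut = b ∧ ρ' Reg.rowCut = a ∧ ρ' Reg.count = wedgeCount S b a := by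
  subst hb ha
  set m := X.depth (ρ Reg.colCut - ρ Reg.rowCut)
  have hwedge : wedgeCount S (ρ Reg.colCut) (ρ Reg.rowCut) ≤ X.size :=
    hX.size_eq ▸ Finset.card_filter_le _ _
  refine (Runs.ite (t := setupProg.baseCost + (m * iterationCost +
    ((Expr.reg Reg.remaining).cost + 1))) (t' := 1)
    ((Evaluates.reg Reg.rowCut).lt (Evaluates.reg Reg.colCut) (h.lt_two_pow (by omega)))
    (fun hlt => ?_) fun hlt => ?_).mono ?_ fun _ hρ' => hρ'
  · have hlt : ρ Reg.rowCut < ρ Reg.colCut := by simpa using hlt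
    refine ((hX.runs_setupProg h hcount hlt hle).mono le_rfl fun ρ₁ hρ₁ => ?_).seq
    refine (Runs.loop (I := X.InDescent T _ _ _) (fun k ρ' hρ' => ?_)
      (fun k ρ' hρ' => h.runs_roundProg hwedge hρ') hρ₁).mono le_rfl ?_
    · exact (Evaluates.reg Reg.remaining).congr hρ'.2.1
    · rintro ρ' ⟨⟨L, hL⟩, -, hb, ha⟩
      exact ⟨hb, ha, hL.count_eq⟩
  · have hle : ρ Reg.colCut ≤ ρ Reg.rowCut := by simpa using hlt
    exact Runs.skip ⟨rfl, rfl, hcount.trans (wedgeCount_eq_zero hS hle).symm⟩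
  · simp only [wedgeProg, Prog.baseCost]
    omega

theorem evaluates_answerExpr (Q : Quadrant) {x y : ℕ} {ρ : ℕ → ℕ} (hx : x ≤ n) (hy : y ≤ n)
    (hb : ρ Reg.colCut = x + Q.colShift) (ha : ρ Reg.rowCut = y + Q.rowShift)
    (hcount : ρ Reg.count = wedgeCount S (x + Q.colShift) (y + Q.rowShift)) :
    Evaluates (X.memory w Z) ρ (answerExpr Q) (dominanceCount S x y Q) := by
  have hb_le := Quadrant.add_colShift_le hx Q
  have ha_le := Quadrant.add_rowShift_le hy Q
  have hn := hX.succ_lt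
  have hcard := hX.card_le h
  have col := (h.read .colStart ((Evaluates.reg _).congr hb) (hb_le.trans_lt hn)
    (hX.colStart_le h hb_le)).congr (hX.colStart_eq _ hb_le)
  have row := (h.read .rowStart ((Evaluates.reg _).congr ha) (ha_le.trans_lt hn)
    (hX.rowStart_le h ha_le)).congr (hX.rowStart_eq _ ha_le)
  have wedge := (Evaluates.reg (μ := X.memory w Z) Reg.count).congr hcount
  have size := (h.const (ρ := ρ) .size h.size_le).congr hX.size_eq
  have hrow : rowCount S (y + Q.rowShift) ≤ S.card := Finset.card_filter_le _ _
  have hwedge : wedgeCount S (x + Q.colShift) (y + Q.rowShift) ≤ S.card :=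
    Finset.card_filter_le _ _
  cases Q with
  | leLe =>
    have hQ := dominanceCount_leLe_add S x y
    exact (col.sub wedge (Nat.le.intro ((add_comm _ _).trans hQ))).congr
      (Nat.sub_eq_of_eq_add hQ.symm)
  | leGe => exact wedge.congr (dominanceCount_leGe S x y).symm
  | geLe =>
    have hQ := dominanceCount_geLe_add S x y
    exact ((row.add wedge (h.lt_two_pow (by omega))).sub col
      (Nat.le.intro ((add_comm _ _).trans hQ))).congr (Nat.sub_eq_of_eq_add hQ.symm)
  | geGe =>
    have hQ := dominanceCount_geGe_add S x y
    have hsub := Nat.sub_eq_of_eq_add hQ.symm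
    exact ((size.sub row hrow).sub wedge (Nat.le.intro ((add_comm _ _).trans hsub.symm))).congr
      (Nat.sub_eq_of_eq_add hsub)

theorem runs_queryProg (hS : ∀ p ∈ S, p.2 ≤ p.1) (Q : Quadrant) {x y : ℕ} {ρ : ℕ → ℕ}
    (hx : x ≤ n) (hy : y ≤ n) (hb : ρ Reg.colCut = x) (ha : ρ Reg.rowCut = y)
    (hcount : ρ Reg.count = 0) :
    Runs (X.memory w Z) (queryProg Q) ρ
      ((queryProg Q).baseCost + X.depth (x + Q.colShift - (y + Q.rowShift)) * iterationCost)
      fun ρ' => ρ' 0 = dominanceCount S x y Q := by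
  have hb_le := Quadrant.add_colShift_le hx Q
  have ha_le := Quadrant.add_rowShift_le hy Q
  have hn := hX.succ_lt
  have lit {k : ℕ} {ρ' : ℕ → ℕ} (hk : k ≤ n + 1) :=
    Evaluates.lit (μ := X.memory w Z) (ρ := ρ') (k := k) (h.lt_two_pow (by omega))
  let ρ₁ := Function.update ρ Reg.colCut (x + Q.colShift)
  let ρ₂ := Function.update ρ₁ Reg.rowCut (y + Q.rowShift)
  have hcol : Evaluates (X.memory w Z) ρ (.reg Reg.colCut + .lit Q.colShift) (x + Q.colShift) :=
    ((Evaluates.reg _).congr hb).add (lit ((Nat.le_add_left _ _).trans hb_le))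
      (h.lt_two_pow (by omega))
  have hrow : Evaluates (X.memory w Z) ρ₁ (.reg Reg.rowCut + .lit Q.rowShift) (y + Q.rowShift) :=
    ((Evaluates.reg _).congr (by exact ha)).add (lit ((Nat.le_add_left _ _).trans ha_le))
      (h.lt_two_pow (by omega))
  have hwedge := hX.runs_wedgeProg h hS (ρ := ρ₂) (b := x + Q.colShift)
    (a := y + Q.rowShift) rfl rfl hcount hb_le
  have hanswer := hwedge.mono le_rfl fun ρ' hρ' =>
    Runs.assign (r := 0) (P := fun ρ'' => ρ'' 0 = dominanceCount S x y Q)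
      (hX.evaluates_answerExpr h Q hx hy hρ'.1 hρ'.2.1 hρ'.2.2) rfl
  refine (Runs.assign_seq hcol (Runs.assign_seq hrow hanswer.seq)).mono ?_ fun _ hρ' => hρ'
  simp only [queryProg, Prog.baseCost]
  omega

end Represents

end Index

section Parameters

/-- The number of bits of a digit. -/
def digitBits (n : ℕ) : ℕ := Nat.log 2 (Nat.log 2 n) / 8 + 1

/-- The number of bits of a count inside a superblock. -/
def countBits (n : ℕ) : ℕ := Nat.log 2 (Nat.log 2 n) + digitBits n + 3

/-- The length of a block: its digits take about half of the bits of `n`. -/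
def digitsPerWord (n : ℕ) : ℕ := Nat.log 2 n / (2 * digitBits n) + 1

/-- A number of digits that suffices to write every number below `2 * d`. -/
def digitsFor (n d : ℕ) : ℕ := (Nat.log 2 d + 2) / digitBits n + 1

/-- The scale of span `d`. Spans of the same scale use the same digit sequences. -/
def scaleOf (n d : ℕ) : ℕ := Nat.log 2 (digitsFor n d) + 1

/-- The number of digits of the keys at scale `j`. -/
def scaleDepth (n j : ℕ) : ℕ := min (2 ^ j) (digitsFor n (n + 1))

/-- The height of a strip of rows at scale `j` is twice this number, which is chosen such that the
keys have `scaleDepth n j` digits. -/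
def scaleBlock (n j : ℕ) : ℕ := min ((2 ^ digitBits n) ^ scaleDepth n j / 2) (n + 1)

variable {n : ℕ}

theorem digitBits_pos : 0 < digitBits n := Nat.succ_pos _

theorem digitsPerWord_pos : 0 < digitsPerWord n := Nat.succ_pos _

theorem log_lt_two_mul_digitBits_mul_digitsPerWord :
    Nat.log 2 n < 2 * digitBits n * digitsPerWord n := by
  rw [digitsPerWord, mul_comm]
  exact Nat.lt_mul_of_div_lt (Nat.lt_succ_self _) (Nat.mul_pos two_pos digitBits_pos)

theorem two_mul_log_le (m : ℕ) : 2 * Nat.log 2 m ≤ m / 2 + 2 := by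
  have four_mul_le (k : ℕ) : 4 * k ≤ 2 ^ k + 4 := by
    induction k with
    | zero => norm_num
    | succ k ih => rcases k with _ | _ | k <;> simp only [pow_succ] at * <;> omega
  rcases Nat.eq_zero_or_pos m with rfl | hm
  · simp
  · have := four_mul_le (Nat.log 2 m)
    have := Nat.pow_log_le_self 2 hm.ne'
    omega

theorem digitsPerWord_le (hn : n ≠ 0) : digitsPerWord n ≤ n :=
  (Nat.succ_le_succ (Nat.div_le_self _ _)).trans (Nat.log_lt_self 2 hn)

theorem digitsPerWord_mul_le (n : ℕ) :
    digitsPerWord n * (2 ^ digitBits n + 1) ≤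
      2 ^ (Nat.log 2 (Nat.log 2 n) + digitBits n + 2) := by
  have hword : digitsPerWord n ≤ 2 ^ (Nat.log 2 (Nat.log 2 n) + 1) :=
    (Nat.succ_le_succ (Nat.div_le_self _ _)).trans (Nat.lt_pow_succ_log_self one_lt_two _)
  have hbase : 2 ^ digitBits n + 1 ≤ 2 ^ (digitBits n + 1) := by
    have := Nat.one_le_two_pow (n := digitBits n)
    omega
  refine (Nat.mul_le_mul hword hbase).trans (le_of_eq ?_)
  ring

theorem digitsPerWord_mul_lt (n : ℕ) :
    digitsPerWord n * (2 ^ digitBits n + 1) < 2 ^ countBits n :=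
  (digitsPerWord_mul_le n).trans_lt (Nat.pow_lt_pow_succ one_lt_two)

theorem blockTable_entries_le (hn : n ≠ 0) :
    (2 ^ digitBits n) ^ digitsPerWord n * digitsPerWord n * (2 ^ digitBits n + 1) ≤ 64 * n := by
  have hword : digitBits n * digitsPerWord n ≤ Nat.log 2 n / 2 + digitBits n := by
    rw [digitsPerWord, mul_add, mul_one, ← Nat.div_div_eq_div_mul]
    exact Nat.add_le_add_right (Nat.mul_div_le _ _) _
  have hexp : digitBits n * digitsPerWord n + (Nat.log 2 (Nat.log 2 n) + digitBits n + 2) ≤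
      Nat.log 2 n + 6 := by
    have := two_mul_log_le (Nat.log 2 n)
    unfold digitBits at hword ⊢
    omega
  calc (2 ^ digitBits n) ^ digitsPerWord n * digitsPerWord n * (2 ^ digitBits n + 1)
    _ ≤ 2 ^ (digitBits n * digitsPerWord n) *
        2 ^ (Nat.log 2 (Nat.log 2 n) + digitBits n + 2) := by
      rw [mul_assoc, ← pow_mul]
      exact Nat.mul_le_mul_left _ (digitsPerWord_mul_le n)
    _ ≤ 2 ^ (Nat.log 2 n + 6) := by
      rw [← pow_add]
      exact Nat.pow_le_pow_right two_pos hexp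
    _ ≤ 64 * n := by
      have := Nat.pow_log_le_self 2 hn
      rw [pow_add]
      omega

theorem countBits_mul_le (hn : 2 ≤ n) : countBits n * (2 ^ digitBits n + 1) ≤ Nat.log 2 n + 32 := by
  set μ := Nat.log 2 (Nat.log 2 n) / 8
  have hlog : (2 ^ μ) ^ 8 ≤ Nat.log 2 n := by
    rw [← pow_mul]
    exact (Nat.pow_le_pow_right two_pos (Nat.div_mul_le_self _ 8)).trans
      (Nat.pow_log_le_self 2 (Nat.log_pos one_lt_two hn).ne')
  have hbits : countBits n ≤ 11 * 2 ^ μ := by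
    have : μ < 2 ^ μ := Nat.lt_two_pow_self
    unfold countBits digitBits
    omega
  have hbase : 2 ^ digitBits n = 2 * 2 ^ μ := pow_succ' 2 μ
  rw [hbase]
  generalize 2 ^ μ = u at *
  rcases Nat.lt_or_ge u 2 with hu | hu
  · interval_cases u <;> omega
  · have hu6 : 2 ^ 6 ≤ u ^ 6 := Nat.pow_le_pow_left hu 6
    calc countBits n * (2 * u + 1) ≤ 11 * u * (3 * u) := Nat.mul_le_mul hbits (by omega)
      _ = 33 * u ^ 2 := by ring
      _ ≤ u ^ 6 * u ^ 2 := Nat.mul_le_mul_right _ (by omega)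
      _ = u ^ 8 := by ring
      _ ≤ Nat.log 2 n + 32 := by omega

theorem countRadix_pow_le (hn : 2 ≤ n) :
    (2 ^ countBits n) ^ (2 ^ digitBits n + 1) ≤ 2 ^ 32 * n := by
  rw [← pow_mul]
  refine (Nat.pow_le_pow_right two_pos (countBits_mul_le hn)).trans ?_
  have := Nat.pow_log_le_self 2 (show n ≠ 0 by omega)
  rw [pow_add]
  omega

theorem log_add_one_le (n : ℕ) : Nat.log 2 (n + 1) ≤ Nat.log 2 n + 1 := by
  rcases Nat.eq_zero_or_pos n with rfl | hn
  · simp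
  · rw [← Nat.log_mul_base one_lt_two hn.ne']
    exact Nat.log_mono_right (by omega)

theorem digitsFor_succ_le (n : ℕ) : digitsFor n (n + 1) ≤ 5 * digitsPerWord n := by
  have hlog := log_add_one_le n
  have hword := log_lt_two_mul_digitBits_mul_digitsPerWord (n := n)
  have hpos := Nat.mul_pos (digitBits_pos (n := n)) (digitsPerWord_pos (n := n))
  refine Nat.succ_le_of_lt ((Nat.div_lt_iff_lt_mul digitBits_pos).2 ?_)
  nlinarith

theorem digitsFor_mono (n : ℕ) {d e : ℕ} (h : d ≤ e) : digitsFor n d ≤ digitsFor n e :=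
  Nat.succ_le_succ (Nat.div_le_div_right (Nat.add_le_add_right (Nat.log_mono_right h) 2))

theorem two_mul_le_base_pow_digitsFor (n d : ℕ) :
    2 * d ≤ (2 ^ digitBits n) ^ digitsFor n d := by
  have hd : d < 2 ^ (Nat.log 2 d + 1) := Nat.lt_pow_succ_log_self one_lt_two _
  rw [← pow_mul]
  calc 2 * d ≤ 2 ^ (Nat.log 2 d + 2) := by
        rw [pow_succ]
        omega
    _ ≤ 2 ^ (digitBits n * digitsFor n d) :=
      Nat.pow_le_pow_right two_pos (Nat.lt_mul_div_succ _ digitBits_pos).le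

theorem base_pow_digitsFor_pred_le {d : ℕ} (hd : d ≠ 0) :
    (2 ^ digitBits n) ^ (digitsFor n d - 1) ≤ 4 * d := by
  rw [← pow_mul, digitsFor, Nat.add_sub_cancel]
  refine (Nat.pow_le_pow_right two_pos (Nat.mul_div_le _ _)).trans ?_
  have := Nat.pow_log_le_self 2 hd
  rw [pow_add]
  omega

theorem two_pow_scaleOf_le (n d : ℕ) : 2 ^ scaleOf n d ≤ 2 * digitsFor n d := by
  have := Nat.pow_log_le_self 2 (show digitsFor n d ≠ 0 from Nat.succ_ne_zero _)
  rw [scaleOf]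
  omega

theorem scaleDepth_scaleOf_le (n d : ℕ) : scaleDepth n (scaleOf n d) ≤ 2 * digitsFor n d :=
  (min_le_left _ _).trans (two_pow_scaleOf_le n d)

theorem digitsFor_le_scaleDepth {d : ℕ} (hd : d ≤ n + 1) :
    digitsFor n d ≤ scaleDepth n (scaleOf n d) :=
  le_min (Nat.lt_pow_succ_log_self one_lt_two _).le (digitsFor_mono n hd)

theorem two_mul_scaleBlock_le (n j : ℕ) :
    2 * scaleBlock n j ≤ (2 ^ digitBits n) ^ scaleDepth n j := by
  rw [scaleBlock]
  omega

theorem le_scaleBlock {d : ℕ} (hd : d ≤ n + 1) : d ≤ scaleBlock n (scaleOf n d) := by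
  have hdigits := (two_mul_le_base_pow_digitsFor n d).trans
    (Nat.pow_le_pow_right (Nat.two_pow_pos _) (digitsFor_le_scaleDepth hd))
  rw [scaleBlock]
  omega

theorem one_lt_log (hn : 3 ≤ n) : 1 < Real.log n := by
  have : (3 : ℝ) ≤ n := by exact_mod_cast hn
  rw [Real.lt_log_iff_exp_lt (by positivity)]
  linarith [Real.exp_one_lt_three]

theorem natLog_le_two_mul_log (d : ℕ) : (Nat.log 2 d : ℝ) ≤ 2 * Real.log d := by
  have h := Real.natLog_le_logb d 2
  have hlog := Real.log_two_gt_d9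
  rw [Real.logb, Nat.cast_ofNat, le_div_iff₀ (by linarith)] at h
  nlinarith [Nat.cast_nonneg (α := ℝ) (Nat.log 2 d)]

theorem log_le_of_le_two_pow {x : ℝ} {k : ℕ} (hx : 0 < x) (h : x ≤ 2 ^ k) : Real.log x ≤ k := by
  have hlog := Real.log_le_log hx h
  rw [Real.log_pow] at hlog
  nlinarith [Real.log_two_lt_d9, Nat.cast_nonneg (α := ℝ) k]

theorem log_log_le_digitBits (hn : 3 ≤ n) : Real.log (Real.log n) ≤ 8 * digitBits n := by
  have hpow : (n : ℝ) ≤ 2 ^ (Nat.log 2 n + 1) := by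
    exact_mod_cast (Nat.lt_pow_succ_log_self one_lt_two n).le
  have hpow' : ((Nat.log 2 n + 1 : ℕ) : ℝ) ≤ 2 ^ (Nat.log 2 (Nat.log 2 n) + 1) := by
    exact_mod_cast Nat.lt_pow_succ_log_self one_lt_two (Nat.log 2 n)
  have hlog : Real.log n ≤ 2 ^ (Nat.log 2 (Nat.log 2 n) + 1) :=
    (log_le_of_le_two_pow (by positivity) hpow).trans hpow'
  refine (log_le_of_le_two_pow (by linarith [one_lt_log hn]) hlog).trans ?_
  have : Nat.log 2 (Nat.log 2 n) + 1 ≤ 8 * digitBits n := by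
    unfold digitBits
    omega
  exact_mod_cast this

theorem digitsFor_le_log {d e : ℕ} (hn : 3 ≤ n) (hd : d ≤ e + 1) :
    (digitsFor n d : ℝ) ≤ 16 * (1 + Real.log e / Real.log (Real.log n)) := by
  have hpos : 0 < Real.log (Real.log n) := Real.log_pos (one_lt_log hn)
  have hbits : (1 : ℝ) ≤ digitBits n := by exact_mod_cast digitBits_pos
  have hdigits : (digitsFor n d : ℝ) ≤ (Nat.log 2 e + 3) / digitBits n + 1 := by
    have hlog : Nat.log 2 d + 2 ≤ Nat.log 2 e + 3 :=
      Nat.add_le_add_right ((Nat.log_mono_right hd).trans (log_add_one_le e)) 2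
    have hdiv : (digitsFor n d : ℝ) ≤ ((Nat.log 2 e + 3 : ℕ) : ℝ) / digitBits n + 1 := by
      rw [digitsFor, Nat.cast_add_one]
      gcongr
      exact Nat.cast_div_le.trans (by gcongr)
    exact_mod_cast hdiv
  have hratio : Real.log e / digitBits n ≤ 8 * (Real.log e / Real.log (Real.log n)) := by
    rw [← mul_div_assoc, div_le_div_iff₀ (by linarith) hpos]
    nlinarith [log_log_le_digitBits hn, Real.log_natCast_nonneg e]
  calc (digitsFor n d : ℝ) ≤ (2 * Real.log e + 3) / digitBits n + 1 := by
        refine hdigits.trans ?_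
        gcongr
        exact natLog_le_two_mul_log e
    _ = 2 * (Real.log e / digitBits n) + 3 / digitBits n + 1 := by ring
    _ ≤ 2 * (8 * (Real.log e / Real.log (Real.log n))) + 3 + 1 := by
      gcongr
      exact div_le_self (by norm_num) hbits
    _ ≤ 16 * (1 + Real.log e / Real.log (Real.log n)) := by linarith

end Parameters

section Construction

/-- The successive lists of the radix sort of a list of `k`-digit numbers in base `f`, most
significant digit first. -/
def radixLevel (f k : ℕ) (Q : List ℕ) : ℕ → List ℕ
  | 0 => Q
  | i + 1 => radixStep f (f ^ (k - 1 - i)) (radixLevel f k Q i)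

theorem lt_of_mem_radixLevel {f k : ℕ} (hf : 0 < f) {Q : List ℕ} (hQ : ∀ q ∈ Q, q < f ^ k) :
    ∀ i, ∀ q ∈ radixLevel f k Q i, q < f ^ (k - i)
  | 0 => hQ
  | i + 1 => fun q hq => by
    rw [Nat.sub_add_eq, Nat.sub_right_comm]
    exact lt_of_mem_radixStep (pow_pos hf _) hq

/-- The keys of the points of `S`, by rows, at the scale `j` for the strips of parity `π`. -/
noncomputable def scaleKeys (n : ℕ) (S : Finset (ℕ × ℕ)) (j π : ℕ) : List ℕ :=
  (pointsByRow S).map (blockKey (scaleBlock n j) π ((2 ^ digitBits n) ^ scaleDepth n j))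

/-- Digit sequence number `2 * (2 ^ j + i) + π` with `i < 2 ^ j` and `π < 2` belongs to scale `j`,
digit `i` and parity `π`. -/
def seqScale (t : ℕ) : ℕ := Nat.log 2 (t / 2)

/-- The digit that sequence `t` holds, where `0` is the leading one. -/
def seqLevel (t : ℕ) : ℕ := t / 2 - 2 ^ seqScale t

/-- The weight of the digits in sequence `t`. -/
def seqUnit (n t : ℕ) : ℕ := (2 ^ digitBits n) ^ (scaleDepth n (seqScale t) - 1 - seqLevel t)

/-- The digit sequences of the dominance counting structure for `S`. -/
noncomputable def seqDigit (n : ℕ) (S : Finset (ℕ × ℕ)) (t p : ℕ) : ℕ :=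
  (radixLevel (2 ^ digitBits n) (scaleDepth n (seqScale t)) (scaleKeys n S (seqScale t) (t % 2))
    (seqLevel t)).getD p 0 / seqUnit n t % 2 ^ digitBits n

/-- The dominance counting structure for `S`, for queries in the `n × n` grid. -/
noncomputable def dominanceIndex (n : ℕ) (S : Finset (ℕ × ℕ)) : Index where
  size := S.card
  base := 2 ^ digitBits n
  blockLen := digitsPerWord n
  radix := 2 ^ countBits n
  digit := seqDigit n S
  unit := seqUnit n
  rowStart := rowCount S
  colStart := colCount S
  strip d := scaleBlock n (scaleOf n d)
  start d := 2 * 2 ^ scaleOf n d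
  depth d := scaleDepth n (scaleOf n d)

/-- The number of digit sequences. -/
def seqCount (n : ℕ) : ℕ := 8 * digitsFor n (n + 1)

/-- The number of entries that suffices for every table. -/
def tableSize (n : ℕ) (S : Finset (ℕ × ℕ)) : ℕ := 2 ^ 32 * (n + S.card)

variable {n : ℕ} {S : Finset (ℕ × ℕ)}

theorem length_scaleKeys (n : ℕ) (S : Finset (ℕ × ℕ)) (j π : ℕ) :
    (scaleKeys n S j π).length = S.card := by
  rw [scaleKeys, List.length_map, length_pointsByRow]

theorem lt_of_mem_scaleKeys {j π q : ℕ} (hq : q ∈ scaleKeys n S j π) :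
    q < (2 ^ digitBits n) ^ scaleDepth n j := by
  simp only [scaleKeys, List.mem_map] at hq
  obtain ⟨p, -, rfl⟩ := hq
  have : 0 < (2 ^ digitBits n) ^ scaleDepth n j := by positivity
  rw [blockKey]
  omega

section Sequence

variable {i j π : ℕ} (hi : i < 2 ^ j) (hπ : π < 2)

include hi hπ

theorem seqScale_eq : seqScale (2 * (2 ^ j + i) + π) = j := by
  rw [seqScale, show (2 * (2 ^ j + i) + π) / 2 = 2 ^ j + i by omega]
  exact Nat.log_eq_of_pow_le_of_lt_pow (Nat.le_add_right _ _) (by rw [pow_succ]; omega)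

theorem seqLevel_eq : seqLevel (2 * (2 ^ j + i) + π) = i := by
  rw [seqLevel, seqScale_eq hi hπ]
  omega

theorem seqUnit_eq (n : ℕ) :
    seqUnit n (2 * (2 ^ j + i) + π) = (2 ^ digitBits n) ^ (scaleDepth n j - 1 - i) := by
  rw [seqUnit, seqScale_eq hi hπ, seqLevel_eq hi hπ]

theorem seqDigit_eq {p : ℕ} (hid : i < scaleDepth n j)
    (hp : p < (radixLevel (2 ^ digitBits n) (scaleDepth n j) (scaleKeys n S j π) i).length) :
    seqDigit n S (2 * (2 ^ j + i) + π) p =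
      (radixLevel (2 ^ digitBits n) (scaleDepth n j) (scaleKeys n S j π) i)[p] /
        (2 ^ digitBits n) ^ (scaleDepth n j - 1 - i) := by
  rw [seqDigit, seqUnit_eq hi hπ, seqScale_eq hi hπ, seqLevel_eq hi hπ,
    show (2 * (2 ^ j + i) + π) % 2 = π by omega, List.getD_eq_getElem _ _ hp]
  refine Nat.mod_eq_of_lt (Nat.div_lt_of_lt_mul ?_)
  rw [← pow_succ, show scaleDepth n j - 1 - i + 1 = scaleDepth n j - i by omega]
  exact lt_of_mem_radixLevel (Nat.two_pow_pos _) (fun _ => lt_of_mem_scaleKeys) i _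
    (List.getElem_mem hp)

end Sequence

theorem codes_radixLevel (n : ℕ) (S : Finset (ℕ × ℕ)) {T j π : ℕ} (hπ : π < 2)
    (hT : 4 * 2 ^ j ≤ T) (m : ℕ) : ∀ i, i + m = scaleDepth n j →
    (dominanceIndex n S).Codes T m (2 * (2 ^ j + i) + π)
      (radixLevel (2 ^ digitBits n) (scaleDepth n j) (scaleKeys n S j π) i) := by
  induction m with
  | zero => exact fun _ _ => trivial
  | succ m ih =>
    intro i him
    have hi : i < 2 ^ j := by
      have : scaleDepth n j ≤ 2 ^ j := min_le_left _ _
      omega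
    obtain rfl : scaleDepth n j - 1 - i = m := by omega
    refine ⟨by omega, seqUnit_eq hi hπ n, fun p hp => seqDigit_eq hi hπ (by omega) hp, ?_⟩
    have hnext : 2 * (2 ^ j + (i + 1)) + π = 2 * (2 ^ j + i) + π + 2 := by ring
    exact hnext ▸ ih (i + 1) (by omega)

theorem seqUnit_le (hn : n ≠ 0) (t : ℕ) : seqUnit n t ≤ 8 * n := by
  calc seqUnit n t ≤ (2 ^ digitBits n) ^ (digitsFor n (n + 1) - 1) := by
        refine Nat.pow_le_pow_right (Nat.two_pow_pos _) ((Nat.sub_le _ _).trans ?_)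
        exact Nat.sub_le_sub_right (min_le_right _ _) 1
    _ ≤ 4 * (n + 1) := base_pow_digitsFor_pred_le n.succ_ne_zero
    _ ≤ 8 * n := by omega

theorem four_mul_two_pow_scaleOf_le {d : ℕ} (hd : d ≤ n + 1) :
    4 * 2 ^ scaleOf n d ≤ seqCount n := by
  have := two_pow_scaleOf_le n d
  have := digitsFor_mono n hd
  rw [seqCount]
  omega

theorem mul_div_succ_mul_le {T s u k N : ℕ} (hT : T ≤ k * s) :
    T * (N / (s * u) + 1) * u ≤ k * (N + s * u) :=
  calc T * (N / (s * u) + 1) * u ≤ k * s * (N / (s * u) + 1) * u := by gcongr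
    _ = k * (s * u * (N / (s * u)) + s * u) := by ring
    _ ≤ k * (N + s * u) := by
      gcongr
      exact Nat.mul_div_le N _

theorem dominanceIndex_fits {w : ℕ} (hn : 2 ≤ n)
    (hw : Index.tableCount * (tableSize n S + 1) ≤ 2 ^ w) :
    (dominanceIndex n S).Fits w (tableSize n S) (seqCount n) := by
  have hsize : tableSize n S = 2 ^ 32 * n + 2 ^ 32 * S.card := mul_add _ _ _
  have hseq : seqCount n ≤ 40 * digitsPerWord n := by
    have := digitsFor_succ_le n
    rw [seqCount]
    omega
  have hword : digitsPerWord n ≤ n := digitsPerWord_le (by omega)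
  have htable := blockTable_entries_le (n := n) (by omega)
  have hsuper : digitsPerWord n * (2 ^ digitBits n + 1) ≤ 64 * n := by
    refine le_trans ?_ htable
    rw [mul_assoc]
    exact Nat.le_mul_of_pos_left _ (by positivity)
  have hblocks := mul_div_succ_mul_le (u := 1) (N := S.card) hseq
  have hsupers := mul_div_succ_mul_le (u := 2 ^ digitBits n + 1) (N := S.card) hseq
  exact
    { addr_le := hw
      one_lt_base := Nat.one_lt_two_pow digitBits_pos.ne'
      blockLen_pos := digitsPerWord_pos
      superLen_lt := digitsPerWord_mul_lt n
      digit_lt := fun t i => Nat.mod_lt _ (Nat.two_pow_pos _)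
      size_le := (by omega : S.card ≤ tableSize n S)
      blockTable_le := htable.trans (by omega)
      radix_pow_le := (countRadix_pow_le hn).trans (by omega)
      blockCount_le := by
        rw [mul_one, mul_one] at hblocks
        exact hblocks.trans (by omega)
      superCount_le := hsupers.trans (by omega)
      unit_le := fun t _ => (seqUnit_le (by omega) t).trans (by omega) }

theorem exists_descent (hS : ∀ p ∈ S, p.2 ≤ p.1) {a b : ℕ} (hab : a < b) (hb : b ≤ n + 1) :
    ∃ L, (dominanceIndex n S).Descent (seqCount n) (wedgeCount S b a)
      (scaleDepth n (scaleOf n (b - a)))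
      (2 * 2 ^ scaleOf n (b - a) + a / scaleBlock n (scaleOf n (b - a)) % 2)
      (b - a / scaleBlock n (scaleOf n (b - a)) * scaleBlock n (scaleOf n (b - a)))
      (rowCount S a) (rowCount S b) 0 L := by
  have hspan : b - a ≤ n + 1 := (Nat.sub_le b a).trans hb
  have hstrip := le_scaleBlock hspan
  have hseq := four_mul_two_pow_scaleOf_le hspan
  have hkey := two_mul_scaleBlock_le n (scaleOf n (b - a))
  generalize scaleOf n (b - a) = j at *
  have hmod := Nat.div_add_mod' a (scaleBlock n j)
  have hmod_lt := Nat.mod_lt a (show 0 < scaleBlock n j by omega)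
  refine ⟨scaleKeys n S j (a / scaleBlock n j % 2),
    { length_eq := length_scaleKeys n S _ _
      codes := codes_radixLevel n S (Nat.mod_lt _ two_pos) hseq _ 0 (zero_add _)
      lt_pow := fun _ => lt_of_mem_scaleKeys
      bound_lt := lt_of_lt_of_le (by omega) hkey
      left_le_right := Finset.card_le_card
        (Finset.monotone_filter_right S fun _ _ hp => hp.trans hab)
      right_le := Finset.card_filter_le _ _
      count_add := (zero_add _).trans (countP_blockKey_extract hS hab hstrip hkey) }⟩

theorem dominanceIndex_represents (hn : n ≠ 0) (hS : ∀ p ∈ S, p.2 ≤ p.1) :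
    (dominanceIndex n S).Represents (tableSize n S) (seqCount n) n S := by
  have hsize : tableSize n S = 2 ^ 32 * n + 2 ^ 32 * S.card := mul_add _ _ _
  have hdigits : digitsFor n (n + 1) ≤ 5 * n :=
    (digitsFor_succ_le n).trans (Nat.mul_le_mul_left 5 (digitsPerWord_le hn))
  exact
    { succ_lt := by omega
      size_eq := rfl
      rowStart_eq := fun _ _ => rfl
      colStart_eq := fun _ _ => rfl
      strip_le := fun _ _ => (min_le_right _ _).trans (by omega)
      start_lt := fun d hd => by
        have := four_mul_two_pow_scaleOf_le hd
        change 2 * 2 ^ scaleOf n d < _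
        rw [seqCount] at this
        omega
      depth_le := fun _ _ => (min_le_right _ _).trans (by omega)
      exists_descent := fun _ _ => exists_descent hS }

end Construction

section Query

open WordRAM

theorem holds_queryState {w : ℕ} (μ : List (BitVec w)) {x y : ℕ} (hx : x < 2 ^ w)
    (hy : y < 2 ^ w) :
    (queryState μ x y).Holds μ fun r => if r = 0 then x else if r = 1 then y else 0 := by
  refine ⟨rfl, fun r => ?_⟩
  simp only [queryState]
  split_ifs
  · exact (BitVec.toNat_ofNat _ _).trans (Nat.mod_eq_of_lt hx)
  · exact (BitVec.toNat_ofNat _ _).trans (Nat.mod_eq_of_lt hy)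
  · exact BitVec.toNat_zero

theorem baseCost_queryProg_le (Q : Quadrant) : (Index.queryProg Q).baseCost ≤ 100 := by
  cases Q <;> decide

theorem add_colShift_sub_le (Q : Quadrant) (x y : ℕ) :
    x + Q.colShift - (y + Q.rowShift) ≤ Nat.dist x y + 1 := by
  cases Q <;> simp only [Quadrant.colShift, Quadrant.rowShift, Nat.dist] <;> omega

theorem cost_le {n d e t b k : ℕ} (hn : 3 ≤ n) (hd : d ≤ e + 1)
    (ht : t ≤ b + scaleDepth n (scaleOf n d) * k) :
    (t : ℝ) ≤ (b + 32 * k : ℕ) * (1 + Real.log e / Real.log (Real.log n)) := by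
  have hratio : 0 ≤ Real.log e / Real.log (Real.log n) :=
    div_nonneg (Real.log_natCast_nonneg e) (Real.log_pos (one_lt_log hn)).le
  have hdepth : (scaleDepth n (scaleOf n d) : ℝ) ≤ 2 * digitsFor n d := by
    exact_mod_cast scaleDepth_scaleOf_le n d
  calc (t : ℝ) ≤ b * 1 + scaleDepth n (scaleOf n d) * k := by
        rw [mul_one]
        exact_mod_cast ht
    _ ≤ b * (1 + Real.log e / Real.log (Real.log n)) +
        2 * (16 * (1 + Real.log e / Real.log (Real.log n))) * k := by
      gcongr
      · linarith
      · exact hdepth.trans (by gcongr; exact digitsFor_le_log hn hd)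
    _ = (b + 32 * k : ℕ) * (1 + Real.log e / Real.log (Real.log n)) := by
      push_cast
      ring

theorem exists_exec_queryProg {n w : ℕ} {S : Finset (ℕ × ℕ)} (hn : 3 ≤ n)
    (hw : Index.tableCount * (tableSize n S + 1) ≤ 2 ^ w) (hS : ∀ p ∈ S, p.2 ≤ p.1) (Q : Quadrant)
    {x y : ℕ} (hx : x ≤ n) (hy : y ≤ n) :
    ∃ (t : ℕ) (final : State w),
      Exec (Index.queryProg Q)
        (queryState ((dominanceIndex n S).memory w (tableSize n S)) x y) t final ∧
      (t : ℝ) ≤ (100 + 32 * Index.iterationCost : ℕ) *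
        (1 + Real.log (Nat.dist x y : ℝ) / Real.log (Real.log (n : ℝ))) ∧
      (final.reg 0).toNat = dominanceCount S x y Q ∧
      final.mem = (dominanceIndex n S).memory w (tableSize n S) := by
  have hfits := dominanceIndex_fits (by omega) hw
  have hrep := dominanceIndex_represents (show n ≠ 0 by omega) hS
  have hn_lt : n < 2 ^ w := hfits.lt_two_pow (by have := hrep.succ_lt; omega)
  obtain ⟨t, ht, final, ρ, hexec, hfinal, hanswer⟩ :=
    hrep.runs_queryProg hfits hS Q hx hy rfl rfl rfl _
      (holds_queryState _ (hx.trans_lt hn_lt) (hy.trans_lt hn_lt))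
  refine ⟨t, final, hexec, cost_le hn (add_colShift_sub_le Q x y) (ht.trans ?_),
    (hfinal.2 0).trans hanswer, hfinal.1⟩
  exact Nat.add_le_add_right (baseCost_queryProg_le Q) _

end Query

theorem mainTheorem9_general :
    ∃ (query : Quadrant → WordRAM.Prog) (A B : ℕ),
      ∀ (n w : ℕ) (S : Finset (ℕ × ℕ)),
        3 ≤ n → A * (n + S.card) ≤ 2 ^ w → (∀ p ∈ S, p.2 ≤ p.1) →
        ∃ mem : List (BitVec w), mem.length ≤ A * (n + S.card) ∧
          ∀ (Q : Quadrant) (x y : ℕ), x ≤ n → y ≤ n →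
            ∃ (t : ℕ) (final : WordRAM.State w),
              WordRAM.Exec (query Q) (WordRAM.queryState mem x y) t final ∧
              (t : ℝ) ≤ B * (1 + Real.log (Nat.dist x y : ℝ) / Real.log (Real.log (n : ℝ))) ∧
              (final.reg 0).toNat = dominanceCount S x y Q ∧
              final.mem = mem := by
  refine ⟨Index.queryProg, Index.tableCount * (2 ^ 32 + 1), 100 + 32 * Index.iterationCost,
    fun n w S hn hw hS => ⟨(dominanceIndex n S).memory w (tableSize n S), ?_,
      fun Q x y => exists_exec_queryProg hn ?_ hS Q⟩⟩
  · rw [Index.memory, WordRAM.length_interleave, tableSize, mul_assoc]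
    gcongr
    omega
  · refine le_trans ?_ hw
    rw [tableSize, mul_assoc]
    gcongr
    omega

/-- For every constant `c` there are query programs, one for each kind of quadrant, and constants
`A`, `B` such that every set of at most `c * n` points below the diagonal of the `n × n` grid has a
data structure of at most `A * n` words, for every word size that can address `A * n` cells, on
which every query at a grid point `(x, y)`, `d = |x - y|`, is answered in register `0` in time at
most `B * (1 + log d / log log n)`, leaving the data structure unchanged. -/
theorem mainTheorem9 (c : ℕ) :
    ∃ (query : Quadrant → WordRAM.Prog) (A B : ℕ),
      ∀ (n w : ℕ) (S : Finset (ℕ × ℕ)),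
        3 ≤ n → A * n ≤ 2 ^ w → BelowDiagonal n S → S.card ≤ c * n →
        ∃ mem : List (BitVec w), mem.length ≤ A * n ∧
          ∀ (Q : Quadrant) (x y : ℕ), x ∈ Finset.Icc 1 n → y ∈ Finset.Icc 1 n →
            ∃ (t : ℕ) (final : WordRAM.State w),
              WordRAM.Exec (query Q) (WordRAM.queryState mem x y) t final ∧
              (t : ℝ) ≤ B * (1 + Real.log (Nat.dist x y : ℝ) / Real.log (Real.log (n : ℝ))) ∧
              (final.reg 0).toNat = dominanceCount S x y Q ∧
              final.mem = mem := by
  obtain ⟨query, A, B, h⟩ := mainTheorem9_general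
  refine ⟨query, A * (c + 1), B, fun n w S hn hw hS hcard => ?_⟩
  have hA : A * (n + S.card) ≤ A * (c + 1) * n := by nlinarith
  obtain ⟨mem, hmem, hquery⟩ := h n w S hn (hA.trans hw) fun p hp => (hS p hp).2.1
  exact ⟨mem, hmem.trans hA, fun Q x y hx hy =>
    hquery Q x y (Finset.mem_Icc.1 hx).2 (Finset.mem_Icc.1 hy).2⟩
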